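/- Let $\mathcal X\subset\mathbb R^d$, $\mathcal Y\subset\mathbb R$, let $\rho$ be a probability measure on $\mathcal Z=\mathcal X\times\mathcal Y$, and let $z_t=(x_t,y_t)$, $t=1,2,\dots$, be independent random variables with law $\rho$. Let $K:\mathcal X\times\mathcal X\to\mathbb R$ be a Mercer kernel (continuous, symmetric, positive semi-definite) with $\kappa:=\sup_{x\in\mathcal X}\sqrt{K(x,x)}<\infty$, let $H_K$ be its reproducing kernel Hilbert space, and write $K_x=K(x,\cdot)\in H_K$. Let $\alpha\in(0,1]$, $L>0$, and let $\phi:\mathcal Y\times\mathbb R\to[0,\infty)$ be a loss function that is convex and differentiable in its second argument, whose derivative $\phi'$ with respect to the second argument satisfies $|\phi'(y,s)-\phi'(y,\tilde s)|\le L|s-\tilde s|^\alpha$ for all $y\in\mathcal Y$ and $s,\tilde s\in\mathbb R$. For $f:\mathcal X\to\mathbb R$ put $\mathcal E(f)=\int_{\mathcal Z}\phi(y,f(x))\,d\rho$. Assume that $f_H\in H_K$ minimizes $\mathcal E$ over $H_K$ and that $\sup_{y\in\mathcal Y}\phi(y,0)<\infty$ and $\sup_{(x,y)\in\mathcal Z}\phi(y,f_H(x))<\infty$.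 Let $A=2\alpha^{\frac{1-\alpha}{1+\alpha}}L^{\frac{2}{1+\alpha}}(1+\alpha)$, and let $(\eta_t)_{t\ge1}$ be positive step sizes with $A\kappa^2\eta_t\le1$ and $\eta_{t+1}\le\eta_t$ for all $t\ge1$ and $\sum_{t=1}^\infty\eta_t^2<\infty$. Let $f_1=0$ and $f_{t+1}=f_t-\eta_t\,\phi'(y_t,f_t(x_t))K_{x_t}$ for $t\ge1$. Then there is a constant $\widetilde C'$, independent of $T$, $\widetilde T$ and $\delta$, such that for all integers $1\le\widetilde T\le T$ and all $\delta\in(0,1)$, with probability at least $1-\delta$, $$\mathcal E(f_{T+1})-\mathcal E(f_H)\le\widetilde C'\max\Big\{\Big[\sum_{t=\widetilde T}^{T}\eta_t\Big]^{-1},\ \eta_{\widetilde T}^{\alpha},\ \sum_{t=\widetilde T}^{T}\eta_t^{1+\alpha}\Big\}\log^2\frac{3T}{\delta}.$$ -/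

import Mathlib

open MeasureTheory ProbabilityTheory

/-- A Mercer kernel: a continuous, symmetric, positive semi-definite real function of two
variables. -/
structure IsMercerKernel {X : Type*} [TopologicalSpace X] (K : X → X → ℝ) : Prop where
  continuous : Continuous (fun p : X × X => K p.1 p.2)
  symm : ∀ x y, K x y = K y x
  posSemidef : ∀ (n : ℕ) (x : Fin n → X) (c : Fin n → ℝ),
    0 ≤ ∑ i, ∑ j, c i * c j * K (x i) (x j)

/-- `H` is the reproducing kernel Hilbert space `H_K` of the kernel `K`
(unique up to an isometry that respects the evaluation of functions). -/
def IsRKHSOf {X : Type*} (H : Type*) [NormedAddCommGroup H] [InnerProductSpace ℝ H]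
    [CompleteSpace H] [RKHS ℝ H X ℝ] (K : X → X → ℝ) : Prop :=
  ∀ x y, RKHS.kernel H x y (1 : ℝ) = K x y

/-- The function `K_x = K(x, ·)` as an element of `H`; it satisfies `⟪f, K_x⟫ = f x`. -/
noncomputable def kernelSection {X : Type*} (H : Type*) [NormedAddCommGroup H]
    [InnerProductSpace ℝ H] [CompleteSpace H] [RKHS ℝ H X ℝ] (x : X) : H :=
  RKHS.kerFun H x (1 : ℝ)

/-- `κ = sup_x √(K(x,x))`. -/
noncomputable def kernelRadius {X : Type*} (K : X → X → ℝ) : ℝ := ⨆ x, √(K x x)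

/-- A loss function `φ : Y × ℝ → ℝ₊` that is convex and differentiable in the second argument,
with `(α, L)`-Hölder continuous derivative. -/
structure IsHolderLoss {Y : Type*} [MeasurableSpace Y] (φ : Y → ℝ → ℝ) (α L : ℝ) : Prop where
  measurable : Measurable (fun p : Y × ℝ => φ p.1 p.2)
  nonneg : ∀ y s, 0 ≤ φ y s
  convex : ∀ y, ConvexOn ℝ Set.univ (φ y)
  differentiable : ∀ y, Differentiable ℝ (φ y)
  holder : ∀ y s s', |deriv (φ y) s - deriv (φ y) s'| ≤ L * |s - s'| ^ α

/-- The generalization error `ℰ(f) = ∫ φ(y, f(x)) dρ(x, y)`. -/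
noncomputable def genError {X Y : Type*} [MeasurableSpace X] [MeasurableSpace Y]
    (ρ : Measure (X × Y)) (φ : Y → ℝ → ℝ) (f : X → ℝ) : ℝ :=
  ∫ z, φ z.2 (f z.1) ∂ρ

/-- Online gradient descent along the examples `z 1, z 2, …` with step sizes `η 1, η 2, …`:
`f₁ = 0` and `f_{t+1} = f_t - η_t φ'(y_t, f_t(x_t)) K_{x_t}` for `t ≥ 1`.
The index `0` is not used (the value there is a dummy). -/
noncomputable def ogd {X Y : Type*} (H : Type*) [NormedAddCommGroup H]
    [InnerProductSpace ℝ H] [CompleteSpace H] [RKHS ℝ H X ℝ]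
    (φ : Y → ℝ → ℝ) (η : ℕ → ℝ) (z : ℕ → X × Y) : ℕ → H
  | 0 => 0
  | 1 => 0
  | t + 2 => ogd H φ η z (t + 1) -
      (η (t + 1) * deriv (φ (z (t + 1)).2) (ogd H φ η z (t + 1) (z (t + 1)).1)) •
        kernelSection H (z (t + 1)).1

/-- The constant `A = 2 α^{(1-α)/(1+α)} L^{2/(1+α)} (1+α)`. -/
noncomputable def stepConst (α L : ℝ) : ℝ :=
  2 * α ^ ((1 - α) / (1 + α)) * L ^ (2 / (1 + α)) * (1 + α)

/-! With `k (x, y) = K_x`, the recursion is stochastic gradient descent for a convex loss of `⟪k z,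
f⟫`. Three tail estimates, each failing with probability at most `exp (-ℓ)`, carry the proof. All
rest on a Chernoff bound for sums whose increments have controlled conditional exponential moments
(`measure_sum_Ico_ge_le`) and on Hoeffding's lemma.

Iterates stay bounded (`measure_norm_sq_sgd_ge_le`). By monotonicity of the derivative and its
Hölder growth, a step changes `‖f - fs‖ ^ 2` by `O(a ^ 2)` plus a noise term involving only the
derivative at `fs`. That noise is centred because the risk gradient vanishes at the minimizer, and
its size is `O(a * ‖f - fs‖)`. Since the squares of the steps are summable, a discount factor
bounded away from zero absorbs its variance. Hence `‖f - fs‖ ^ 2 ≤ M = O(1 + ℓ)` at any fixed time.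

The averaged risk is small (`measure_sum_excess_ge_le`). In the ball, the usual convex regret bound
and Hoeffding's inequality bound the weighted sum of excess risks by `O((1 + M) * (1 + ℓ))`, so some
iterate `s` in the window has excess risk at most this divided by the sum of the steps.

The risk hardly rises afterwards (`measure_risk_increase_ge_le`). By smoothness the risk changes by
a descent term `-a * ‖v‖ ^ 2`, with `v` the risk gradient, plus noise and `O(a ^ (1 + α))`. The
noise variance is proportional to `a ^ 2 * ‖v‖ ^ 2`, so the descent pays for it, leaving a
fluctuation of order `(1 + M) * a m * ℓ`.

A union bound over the window gives the last iterate. One logarithm comes from `M` and one from the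
tails. -/

theorem ConvexOn.add_deriv_mul_sub_le {f : ℝ → ℝ} (hf : ConvexOn ℝ Set.univ f)
    (hd : Differentiable ℝ f) (s t : ℝ) : f s + deriv f s * (t - s) ≤ f t := by
  rcases lt_trichotomy s t with h | h | h
  · have := hf.deriv_le_slope (Set.mem_univ s) (Set.mem_univ t) h (hd s)
    rw [slope_def_field, le_div_iff₀ (by linarith)] at this
    linarith
  · subst h; simp
  · have := hf.slope_le_deriv (Set.mem_univ t) (Set.mem_univ s) h (hd s)
    rw [slope_def_field, div_le_iff₀ (by linarith)] at this
    linarith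

/-- A linear prediction problem in a Hilbert space: the prediction of `f` at `z` is `⟪k z, f⟫`, and
`ψ z` is a convex loss with Hölder continuous derivative that is bounded by `B` along the
predictions of a reference element `fs`. -/
structure IsHolderModel {Z H : Type*} [MeasurableSpace Z] [NormedAddCommGroup H]
    [InnerProductSpace ℝ H] (k : Z → H) (ψ : Z → ℝ → ℝ) (α L κ B : ℝ) (fs : H) : Prop where
  hα0 : 0 < α
  hα1 : α ≤ 1
  hL : 0 < L
  hκ : 0 ≤ κ
  hB : 0 ≤ B
  k_meas : StronglyMeasurable k
  k_norm : ∀ z, ‖k z‖ ≤ κ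
  ψ_meas : Measurable (fun p : Z × ℝ => ψ p.1 p.2)
  nonneg : ∀ z s, 0 ≤ ψ z s
  convex : ∀ z, ConvexOn ℝ Set.univ (ψ z)
  diff : ∀ z, Differentiable ℝ (ψ z)
  holder : ∀ z s s', |deriv (ψ z) s - deriv (ψ z) s'| ≤ L * |s - s'| ^ α
  bound : ∀ z, ψ z (inner ℝ (k z) fs) ≤ B

/-! ### Pointwise and integrated estimates for Hölder losses -/

noncomputable section

variable {Z H : Type*} [MeasurableSpace Z] [NormedAddCommGroup H] [InnerProductSpace ℝ H]

/-- The derivative of the loss at the prediction of `f`. -/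
def lossDeriv (k : Z → H) (ψ : Z → ℝ → ℝ) (f : H) (z : Z) : ℝ := deriv (ψ z) (inner ℝ (k z) f)

/-- The loss at the prediction of `f`. -/
def lossAt (k : Z → H) (ψ : Z → ℝ → ℝ) (f : H) (z : Z) : ℝ := ψ z (inner ℝ (k z) f)

/-- The expected loss. -/
def risk (ρ : Measure Z) (k : Z → H) (ψ : Z → ℝ → ℝ) (f : H) : ℝ := ∫ z, lossAt k ψ f z ∂ρ

/-- The gradient of the expected loss. -/
def riskGrad (ρ : Measure Z) (k : Z → H) (ψ : Z → ℝ → ℝ) (f : H) : H :=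
  ∫ z, lossDeriv k ψ f z • k z ∂ρ

/-- A Lipschitz-type constant of a Hölder model. -/
def growthConst (L κ B : ℝ) : ℝ := B + 2 * L + L * κ

namespace IsHolderModel

variable {k : Z → H} {ψ : Z → ℝ → ℝ} {α L κ B : ℝ} {fs : H}

/-- A nonnegative convex function cannot fall by more than its value: the tangent at `s + u`, with
`u = ±1`, bounds the slope there from one side, and the Hölder condition moves that slope back to
`s` at cost `L`. -/
theorem abs_deriv_le (h : IsHolderModel k ψ α L κ B fs) (z : Z) (s : ℝ) :
    |deriv (ψ z) s| ≤ ψ z s + L := by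
  have key : ∀ u : ℝ, |u| = 1 → deriv (ψ z) s * u ≥ - ψ z s - L := by
    intro u hu
    have h1 := (h.convex z).add_deriv_mul_sub_le (h.diff z) (s + u) s
    have h2 := h.holder z (s + u) s
    have h3 := h.nonneg z (s + u)
    simp only [add_sub_cancel_left, hu, Real.one_rpow, mul_one] at h2
    have h4 : |(deriv (ψ z) (s + u) - deriv (ψ z) s) * u| ≤ L := by rwa [abs_mul, hu, mul_one]
    have := abs_le.1 h4
    nlinarith
  have h1 := key 1 (by simp)
  have h2 := key (-1) (by simp)
  rw [abs_le]; constructor <;> linarith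

/-- Convexity replaces integration of the derivative: the tangent at `t`, evaluated at `s`, has
slope differing from that at `s` by at most `L * |t - s| ^ α`. -/
theorem le_smooth (h : IsHolderModel k ψ α L κ B fs) (z : Z) (s t : ℝ) :
    ψ z t ≤ ψ z s + deriv (ψ z) s * (t - s) + L * |t - s| ^ (1 + α) := by
  have h1 := (h.convex z).add_deriv_mul_sub_le (h.diff z) t s
  have h2 := h.holder z t s
  have h3 : (deriv (ψ z) t - deriv (ψ z) s) * (t - s) ≤ L * |t - s| ^ (1 + α) := by
    calc _ ≤ |(deriv (ψ z) t - deriv (ψ z) s) * (t - s)| := le_abs_self _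
      _ = |deriv (ψ z) t - deriv (ψ z) s| * |t - s| := abs_mul _ _
      _ ≤ (L * |t - s| ^ α) * |t - s| := by gcongr
      _ = _ := by
        rw [Real.rpow_add' (abs_nonneg _) (by linarith [h.hα0]), Real.rpow_one]; ring
  linarith

theorem abs_inner_le (h : IsHolderModel k ψ α L κ B fs) (z : Z) (f : H) :
    |inner ℝ (k z) f| ≤ κ * ‖f‖ :=
  (abs_real_inner_le_norm _ _).trans (by gcongr; exact h.k_norm z)

theorem growthConst_nonneg (h : IsHolderModel k ψ α L κ B fs) : 0 ≤ growthConst L κ B := by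
  have := h.hL; have := h.hκ; have := h.hB
  unfold growthConst; positivity

theorem abs_lossDeriv_center_le (h : IsHolderModel k ψ α L κ B fs) (z : Z) :
    |lossDeriv k ψ fs z| ≤ growthConst L κ B := by
  have h1 := h.abs_deriv_le z (inner ℝ (k z) fs)
  have h2 := h.bound z
  have := mul_nonneg h.hL.le h.hκ
  have := h.hL
  unfold lossDeriv growthConst
  linarith

theorem abs_lossDeriv_sub_le (h : IsHolderModel k ψ α L κ B fs) (z : Z) (f : H) :
    |lossDeriv k ψ f z - lossDeriv k ψ fs z| ≤ L * |inner ℝ (k z) (f - fs)| ^ α := by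
  rw [inner_sub_right]; exact h.holder z _ _

/-- The derivative at `fs` is at most `B + L`, and the Hölder increment grows at most linearly
because `x ^ α ≤ 1 + x`. -/
theorem abs_lossDeriv_le (h : IsHolderModel k ψ α L κ B fs) (z : Z) (f : H) :
    |lossDeriv k ψ f z| ≤ growthConst L κ B * (1 + ‖f - fs‖) := by
  have h1 := h.abs_deriv_le z (inner ℝ (k z) fs)
  have h2 := h.bound z
  have h3 := h.abs_lossDeriv_sub_le z f
  have h4 := h.abs_inner_le z (f - fs)
  have hL := h.hL
  have hB := h.hB
  have h5 : |inner ℝ (k z) (f - fs)| ^ α ≤ 1 + κ * ‖f - fs‖ := by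
    have h0 := abs_nonneg (inner ℝ (k z) (f - fs))
    calc |inner ℝ (k z) (f - fs)| ^ α ≤ (1 + |inner ℝ (k z) (f - fs)|) ^ α :=
          Real.rpow_le_rpow h0 (by linarith) h.hα0.le
      _ ≤ (1 + |inner ℝ (k z) (f - fs)|) ^ (1 : ℝ) :=
          Real.rpow_le_rpow_of_exponent_le (by linarith) h.hα1
      _ ≤ _ := by rw [Real.rpow_one]; linarith
  have h6 : |lossDeriv k ψ f z| ≤ |lossDeriv k ψ f z - lossDeriv k ψ fs z|
      + |lossDeriv k ψ fs z| := by
    simpa using abs_add_le (lossDeriv k ψ f z - lossDeriv k ψ fs z) (lossDeriv k ψ fs z)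
  have h7 : L * |inner ℝ (k z) (f - fs)| ^ α ≤ L * (1 + κ * ‖f - fs‖) := by gcongr
  have hn := norm_nonneg (f - fs)
  have h8 := mul_nonneg hB hn
  have h9 := mul_nonneg hL.le hn
  have h10 := mul_nonneg hL.le h.hκ
  unfold growthConst
  unfold lossDeriv at *
  nlinarith

theorem abs_lossAt_sub_le (h : IsHolderModel k ψ α L κ B fs) (z : Z) (f : H) :
    |lossAt k ψ f z - lossAt k ψ fs z| ≤ growthConst L κ B * κ * (1 + ‖f - fs‖) ^ 2 := by
  have h1 := (h.convex z).add_deriv_mul_sub_le (h.diff z) (inner ℝ (k z) fs) (inner ℝ (k z) f)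
  have h2 := (h.convex z).add_deriv_mul_sub_le (h.diff z) (inner ℝ (k z) f) (inner ℝ (k z) fs)
  have hn := norm_nonneg (f - fs)
  have hG := h.growthConst_nonneg
  have hκ := h.hκ
  have key : ∀ d : ℝ, |d| ≤ growthConst L κ B * (1 + ‖f - fs‖) →
      |d * inner ℝ (k z) (f - fs)| ≤ growthConst L κ B * κ * (1 + ‖f - fs‖) ^ 2 := by
    intro d hd
    rw [abs_mul]
    calc _ ≤ (growthConst L κ B * (1 + ‖f - fs‖)) * (κ * ‖f - fs‖) := by
          gcongr; exact h.abs_inner_le z _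
      _ ≤ (growthConst L κ B * (1 + ‖f - fs‖)) * (κ * (1 + ‖f - fs‖)) := by gcongr; linarith
      _ = _ := by ring
  have h3 := abs_le.1 (key _ (h.abs_lossDeriv_le z f))
  have h4 := abs_le.1 (key _ ((h.abs_lossDeriv_center_le z).trans
    (le_mul_of_one_le_right hG (by linarith))))
  unfold lossDeriv at h3 h4
  rw [inner_sub_right] at h3 h4
  unfold lossAt
  rw [abs_le]
  constructor <;> linarith

theorem abs_lossAt_le (h : IsHolderModel k ψ α L κ B fs) (z : Z) (f : H) :
    |lossAt k ψ f z| ≤ B + growthConst L κ B * κ * (1 + ‖f - fs‖) ^ 2 := by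
  have h1 := abs_le.1 (h.abs_lossAt_sub_le z f)
  have h2 := h.bound z
  have h3 : 0 ≤ lossAt k ψ f z := h.nonneg _ _
  rw [abs_of_nonneg h3]
  unfold lossAt at *
  linarith

theorem measurable_deriv (h : IsHolderModel k ψ α L κ B fs) :
    Measurable (fun p : Z × ℝ => deriv (ψ p.1) p.2) := by
  refine measurable_of_tendsto_metrizable
    (f := fun (n : ℕ) (p : Z × ℝ) =>
      ((1 : ℝ) / (n + 1))⁻¹ • (ψ p.1 (p.2 + 1 / (n + 1)) - ψ p.1 p.2)) ?_ ?_
  · intro n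
    have h1 : Measurable (fun p : Z × ℝ => ψ p.1 (p.2 + 1 / (n + 1))) :=
      h.ψ_meas.comp (measurable_fst.prodMk (measurable_snd.add_const _))
    exact (h1.sub h.ψ_meas).const_smul ((1 : ℝ) / (n + 1))⁻¹
  · rw [tendsto_pi_nhds]
    intro p
    have h1 := (h.diff p.1 p.2).hasDerivAt.tendsto_slope_zero_right
    refine h1.comp (tendsto_nhdsWithin_iff.2 ⟨tendsto_one_div_add_atTop_nhds_zero_nat, ?_⟩)
    filter_upwards with n
    simp only [Set.mem_Ioi]
    positivity

theorem measurable_inner (h : IsHolderModel k ψ α L κ B fs) {A : Type*} [MeasurableSpace A]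
    {u : A → Z} {f : A → H} (hu : Measurable u) (hf : StronglyMeasurable f) :
    Measurable fun a => inner ℝ (k (u a)) (f a) :=
  ((h.k_meas.comp_measurable hu).inner hf).measurable

theorem measurable_lossAt (h : IsHolderModel k ψ α L κ B fs) {A : Type*} [MeasurableSpace A]
    {u : A → Z} {f : A → H} (hu : Measurable u) (hf : StronglyMeasurable f) :
    Measurable fun a => lossAt k ψ (f a) (u a) :=
  h.ψ_meas.comp (hu.prodMk (h.measurable_inner hu hf))

theorem measurable_lossDeriv (h : IsHolderModel k ψ α L κ B fs) {A : Type*} [MeasurableSpace A]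
    {u : A → Z} {f : A → H} (hu : Measurable u) (hf : StronglyMeasurable f) :
    Measurable fun a => lossDeriv k ψ (f a) (u a) :=
  h.measurable_deriv.comp (hu.prodMk (h.measurable_inner hu hf))

theorem stronglyMeasurable_grad (h : IsHolderModel k ψ α L κ B fs) {A : Type*}
    [MeasurableSpace A] {u : A → Z} {f : A → H} (hu : Measurable u) (hf : StronglyMeasurable f) :
    StronglyMeasurable fun a => lossDeriv k ψ (f a) (u a) • k (u a) :=
  (h.measurable_lossDeriv hu hf).stronglyMeasurable.smul (h.k_meas.comp_measurable hu)

variable {ρ : Measure Z} [IsProbabilityMeasure ρ]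

theorem integrable_lossAt (h : IsHolderModel k ψ α L κ B fs) (f : H) :
    Integrable (lossAt k ψ f) ρ :=
  Integrable.of_bound
    (h.measurable_lossAt measurable_id stronglyMeasurable_const).aestronglyMeasurable _
    (ae_of_all _ fun z => h.abs_lossAt_le z f)

theorem norm_grad_le (h : IsHolderModel k ψ α L κ B fs) (f : H) (z : Z) :
    ‖lossDeriv k ψ f z • k z‖ ≤ growthConst L κ B * κ * (1 + ‖f - fs‖) := by
  rw [norm_smul, Real.norm_eq_abs]
  have hn := norm_nonneg (f - fs)
  have hG := h.growthConst_nonneg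
  calc _ ≤ (growthConst L κ B * (1 + ‖f - fs‖)) * κ := by
        gcongr
        · exact h.abs_lossDeriv_le z f
        · exact h.k_norm z
    _ = _ := by ring

theorem integrable_grad (h : IsHolderModel k ψ α L κ B fs) (f : H) :
    Integrable (fun z => lossDeriv k ψ f z • k z) ρ :=
  Integrable.of_bound
    (h.stronglyMeasurable_grad measurable_id stronglyMeasurable_const).aestronglyMeasurable _
    (ae_of_all _ fun z => h.norm_grad_le f z)

theorem norm_riskGrad_le (h : IsHolderModel k ψ α L κ B fs) (f : H) :
    ‖riskGrad ρ k ψ f‖ ≤ growthConst L κ B * κ * (1 + ‖f - fs‖) := by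
  have := norm_integral_le_of_norm_le_const (μ := ρ) (ae_of_all _ fun z => h.norm_grad_le f z)
  simpa [riskGrad] using this

theorem integral_lossDeriv_mul [CompleteSpace H] (h : IsHolderModel k ψ α L κ B fs) (f g : H) :
    Integrable (fun z => lossDeriv k ψ f z * inner ℝ (k z) g) ρ ∧
      ∫ z, lossDeriv k ψ f z * inner ℝ (k z) g ∂ρ = inner ℝ (riskGrad ρ k ψ f) g := by
  have h1 : (fun z => lossDeriv k ψ f z * inner ℝ (k z) g) =
      fun z => inner ℝ g (lossDeriv k ψ f z • k z) := by
    funext z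
    rw [inner_smul_right, real_inner_comm]
  rw [h1]
  refine ⟨(h.integrable_grad f).const_inner g, ?_⟩
  rw [integral_inner (h.integrable_grad f), real_inner_comm]
  rfl

theorem risk_le_smooth [CompleteSpace H] (h : IsHolderModel k ψ α L κ B fs) (f g : H) :
    risk ρ k ψ g ≤ risk ρ k ψ f + inner ℝ (riskGrad ρ k ψ f) (g - f)
      + L * (κ * ‖g - f‖) ^ (1 + α) := by
  obtain ⟨hi, he⟩ := h.integral_lossDeriv_mul (ρ := ρ) f (g - f)
  have hf := h.integrable_lossAt (ρ := ρ) f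
  rw [← he]
  unfold risk
  have h1 : ∫ z, (lossAt k ψ f z + lossDeriv k ψ f z * inner ℝ (k z) (g - f)
      + L * (κ * ‖g - f‖) ^ (1 + α)) ∂ρ = (∫ z, lossAt k ψ f z ∂ρ)
      + (∫ z, lossDeriv k ψ f z * inner ℝ (k z) (g - f) ∂ρ) + L * (κ * ‖g - f‖) ^ (1 + α) := by
    rw [integral_add (f := fun z => lossAt k ψ f z + lossDeriv k ψ f z * inner ℝ (k z) (g - f))
      (hf.add hi) (integrable_const _), integral_add hf hi]
    simp
  rw [← h1]
  refine integral_mono (h.integrable_lossAt g) ((hf.add hi).add (integrable_const _)) fun z => ?_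
  have h2 := h.le_smooth z (inner ℝ (k z) f) (inner ℝ (k z) g)
  rw [← inner_sub_right] at h2
  have h3 : |inner ℝ (k z) (g - f)| ^ (1 + α) ≤ (κ * ‖g - f‖) ^ (1 + α) :=
    Real.rpow_le_rpow (abs_nonneg _) (h.abs_inner_le z _) (by linarith [h.hα0])
  have h4 := mul_le_mul_of_nonneg_left h3 h.hL.le
  unfold lossAt lossDeriv
  linarith

/-- Moving from `fs` by `-t • g` gains `t * ‖g‖ ^ 2` to first order and costs only `O(t ^ (1 + α))`.
Minimality, division by `t` and `t → 0` force `g = 0`. -/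
theorem riskGrad_eq_zero [CompleteSpace H] (h : IsHolderModel k ψ α L κ B fs)
    (hmin : ∀ f, risk ρ k ψ fs ≤ risk ρ k ψ f) : riskGrad ρ k ψ fs = 0 := by
  by_contra hne
  set g := riskGrad ρ k ψ fs with hg
  have hpos : 0 < ‖g‖ ^ 2 := by positivity
  have key : ∀ t : ℝ, 0 < t → ‖g‖ ^ 2 ≤ L * (κ * ‖g‖) ^ (1 + α) * t ^ α := by
    intro t ht
    have h1 := h.risk_le_smooth (ρ := ρ) fs (fs - t • g)
    have h2 := hmin (fs - t • g)
    rw [← hg] at h1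
    have h3 : fs - t • g - fs = -(t • g) := by abel
    have hα := h.hα0
    rw [h3, inner_neg_right, inner_smul_right, real_inner_self_eq_norm_sq, norm_neg, norm_smul,
      Real.norm_of_nonneg ht.le, show κ * (t * ‖g‖) = t * (κ * ‖g‖) by ring,
      Real.mul_rpow ht.le (mul_nonneg h.hκ (norm_nonneg _)),
      Real.rpow_add ht, Real.rpow_one] at h1
    have h4 : t * ‖g‖ ^ 2 ≤ t * (L * (κ * ‖g‖) ^ (1 + α) * t ^ α) := by linarith
    exact le_of_mul_le_mul_left h4 ht
  have hlim : Filter.Tendsto (fun t : ℝ => L * (κ * ‖g‖) ^ (1 + α) * t ^ α)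
      (nhdsWithin 0 (Set.Ioi 0)) (nhds (L * (κ * ‖g‖) ^ (1 + α) * 0 ^ α)) :=
    (((Real.continuousAt_rpow_const 0 α (Or.inr h.hα0.le)).tendsto).mono_left
      nhdsWithin_le_nhds).const_mul _
  rw [Real.zero_rpow h.hα0.ne', mul_zero] at hlim
  have := ge_of_tendsto hlim (by filter_upwards [self_mem_nhdsWithin] with t ht using key t ht)
  linarith

/-- The purpose is to leave a linear term with the derivative at `fs`, which has mean zero at a
minimizer, and an additive error free of `f`. The descent `(d - d₀) * p ≥ 0` given by convexity
absorbs the quadratic term. -/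
theorem norm_sq_step_le (h : IsHolderModel k ψ α L κ B fs) {a R : ℝ} (ha : 0 ≤ a)
    (hR : ∀ s, R ≤ s → a * (κ ^ 2 * L) * s ^ α ≤ s) (f : H) (z : Z) :
    ‖f - (a * lossDeriv k ψ f z) • k z - fs‖ ^ 2 ≤ ‖f - fs‖ ^ 2
      - 2 * a * (lossDeriv k ψ fs z * inner ℝ (k z) (f - fs))
      + 2 * κ ^ 2 * (growthConst L κ B ^ 2 + (L * R ^ α) ^ 2) * a ^ 2 := by
  set p := inner ℝ (k z) (f - fs) with hp
  set d := lossDeriv k ψ f z with hd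
  set d₀ := lossDeriv k ψ fs z with hd₀
  have h1 : ‖f - (a * d) • k z - fs‖ ^ 2 = ‖f - fs‖ ^ 2 - 2 * (a * d) * p
      + (a * d) ^ 2 * ‖k z‖ ^ 2 := by
    rw [show f - (a * d) • k z - fs = (f - fs) - (a * d) • k z by abel, norm_sub_sq_real,
      inner_smul_right, real_inner_comm, ← hp, norm_smul, mul_pow, Real.norm_eq_abs, sq_abs]
    ring
  have h2 : (a * d) ^ 2 * ‖k z‖ ^ 2 ≤ (a * d) ^ 2 * κ ^ 2 := by
    gcongr; exact h.k_norm z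
  have h3 : |d₀| ≤ growthConst L κ B := h.abs_lossDeriv_center_le z
  have h4 : |d - d₀| ≤ L * |p| ^ α := h.abs_lossDeriv_sub_le z f
  have h5 : 0 ≤ (d - d₀) * p := by
    have e1 := (h.convex z).add_deriv_mul_sub_le (h.diff z) (inner ℝ (k z) fs) (inner ℝ (k z) f)
    have e2 := (h.convex z).add_deriv_mul_sub_le (h.diff z) (inner ℝ (k z) f) (inner ℝ (k z) fs)
    rw [hp, hd, hd₀, inner_sub_right]
    unfold lossDeriv
    nlinarith
  -- For `|p| ≤ R` the Hölder bound makes the left side `O(a ^ 2)`. For `|p| ≥ R` the choice of `R`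
  -- gives `a * κ ^ 2 * |d - d₀| ≤ |p|`, so one factor `|d - d₀|` is traded for `|p|`.
  have h6 : a ^ 2 * (κ ^ 2 * (d - d₀) ^ 2) ≤ a * ((d - d₀) * p) + a ^ 2 * (κ ^ 2 * (L * R ^ α) ^ 2) := by
    rcases le_total |p| R with hpR | hpR
    · have e1 : |d - d₀| ≤ L * R ^ α :=
        h4.trans (mul_le_mul_of_nonneg_left
          (Real.rpow_le_rpow (abs_nonneg _) hpR h.hα0.le) h.hL.le)
      have e2 : (d - d₀) ^ 2 ≤ (L * R ^ α) ^ 2 := by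
        rw [← sq_abs]; gcongr
      have e3 : a ^ 2 * (κ ^ 2 * (d - d₀) ^ 2) ≤ a ^ 2 * (κ ^ 2 * (L * R ^ α) ^ 2) := by gcongr
      have := mul_nonneg ha h5
      linarith
    · have e1 := hR _ hpR
      have e2 : a * κ ^ 2 * |d - d₀| ≤ |p| := by
        calc _ ≤ a * κ ^ 2 * (L * |p| ^ α) := by gcongr
          _ = a * (κ ^ 2 * L) * |p| ^ α := by ring
          _ ≤ _ := e1
      have e3 : a * |d - d₀| * (a * κ ^ 2 * |d - d₀|) ≤ a * |d - d₀| * |p| := by gcongr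
      have e4 : |d - d₀| * |p| = (d - d₀) * p := by rw [← abs_mul, abs_of_nonneg h5]
      have e5 : 0 ≤ a ^ 2 * (κ ^ 2 * (L * R ^ α) ^ 2) := by positivity
      have e6 : a ^ 2 * (κ ^ 2 * (d - d₀) ^ 2) = a * |d - d₀| * (a * κ ^ 2 * |d - d₀|) := by
        rw [← sq_abs (d - d₀)]; ring
      have e7 : a * |d - d₀| * |p| = a * ((d - d₀) * p) := by rw [← e4]; ring
      linarith
  have h7 : d ^ 2 ≤ 2 * (d - d₀) ^ 2 + 2 * growthConst L κ B ^ 2 := by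
    have e1 : d₀ ^ 2 ≤ growthConst L κ B ^ 2 := by rw [← sq_abs]; gcongr
    nlinarith [sq_nonneg (d - 2 * d₀)]
  have h8 : (a * d) ^ 2 * κ ^ 2 ≤ a ^ 2 * κ ^ 2 * (2 * (d - d₀) ^ 2 + 2 * growthConst L κ B ^ 2) := by
    calc _ = a ^ 2 * κ ^ 2 * d ^ 2 := by ring
      _ ≤ _ := by gcongr
  linarith

end IsHolderModel
end

/-! ### Exponential moments along independent samples -/

section Chain

variable {Z Ω : Type*} [MeasurableSpace Z] [MeasurableSpace Ω] {P : Measure Ω}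
  [IsProbabilityMeasure P] {ρ : Measure Z} [IsProbabilityMeasure ρ] {z : ℕ → Ω → Z}

/-- Induction on `n`: the newest sample is independent of the past, so by Tonelli it can be
integrated first with the history frozen. This replaces conditional expectations. -/
theorem lintegral_prod_Ico_le_of_iIndepFun (hm : ∀ t, Measurable (z t))
    (hlaw : ∀ t, P.map (z t) = ρ) (hind : iIndepFun z P) {b : ℕ → (ℕ → Z) → Z → ENNReal}
    (hb : ∀ t, Measurable (Function.uncurry (b t)))
    (hdep : ∀ t w w', (∀ i < t, w i = w' i) → b t w = b t w') {c : ℕ → ENNReal}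
    {m n : ℕ}
    (hc : ∀ t, m ≤ t → ∀ w, ∫⁻ x, b t w x ∂ρ ≤ c t) (hmn : m ≤ n) :
    ∫⁻ ω, ∏ t ∈ Finset.Ico m n, b t (fun i => z i ω) (z t ω) ∂P ≤ ∏ t ∈ Finset.Ico m n, c t := by
  classical
  induction n, hmn using Nat.le_induction with
  | base => simp
  | succ n hn ih =>
    obtain ⟨ω₀⟩ : Nonempty Ω := nonempty_of_isProbabilityMeasure P
    set U : Ω → (Finset.range n → Z) := fun ω i => z i ω with hU
    -- A finite history is padded to a full sequence by an arbitrary value; by `hdep` the padding is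
    -- never seen.
    set e : (Finset.range n → Z) → ℕ → Z :=
      fun u i => if h : i ∈ Finset.range n then u ⟨i, h⟩ else z 0 ω₀ with he
    have hUm : Measurable U := measurable_pi_lambda _ fun i => hm i
    have hem : Measurable e := by
      refine measurable_pi_lambda _ fun i => ?_
      by_cases h : i ∈ Finset.range n
      · simp only [he, h, dite_true]
        exact measurable_pi_apply _
      · simp only [he, h, dite_false]
        exact measurable_const
    have heU : ∀ ω i, i < n → e (U ω) i = z i ω := by
      intro ω i hi
      simp [he, hU, hi]
    have hindU : IndepFun U (z n) P := by
      have h1 := hind.indepFun_finset (Finset.range n) {n} (by simp) hm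
      exact h1.comp measurable_id
        (measurable_pi_apply (X := fun _ : ({n} : Finset ℕ) => Z) ⟨n, by simp⟩)
    have hmap : P.map (fun ω => (U ω, z n ω)) = (P.map U).prod ρ := by
      rw [(indepFun_iff_map_prod_eq_prod_map_map hUm.aemeasurable (hm n).aemeasurable).1 hindU,
        hlaw]
    set p : (Finset.range n → Z) → ENNReal :=
      fun u => ∏ t ∈ Finset.Ico m n, b t (e u) (e u t) with hp
    have hpm : Measurable p := Finset.measurable_prod _ fun t _ =>
      (hb t).comp (hem.prodMk ((measurable_pi_apply t).comp hem))
    have hbm : Measurable fun q : (Finset.range n → Z) × Z => b n (e q.1) q.2 :=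
      (hb n).comp ((hem.comp measurable_fst).prodMk measurable_snd)
    have hqm : Measurable fun q : (Finset.range n → Z) × Z => p q.1 * b n (e q.1) q.2 :=
      (hpm.comp measurable_fst).mul hbm
    have hpU : ∀ ω, p (U ω) = ∏ t ∈ Finset.Ico m n, b t (fun i => z i ω) (z t ω) := by
      intro ω
      refine Finset.prod_congr rfl fun t ht => ?_
      have ht' := (Finset.mem_Ico.1 ht).2
      rw [hdep t (e (U ω)) (fun i => z i ω) fun i hi => heU ω i (hi.trans ht'), heU ω t ht']
    have : IsProbabilityMeasure (P.map U) := Measure.isProbabilityMeasure_map hUm.aemeasurable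
    calc ∫⁻ ω, ∏ t ∈ Finset.Ico m (n + 1), b t (fun i => z i ω) (z t ω) ∂P
        = ∫⁻ ω, (fun q : (Finset.range n → Z) × Z => p q.1 * b n (e q.1) q.2) (U ω, z n ω) ∂P := by
          refine lintegral_congr fun ω => ?_
          rw [Finset.prod_Ico_succ_top hn, ← hpU ω,
            hdep n (fun i => z i ω) (e (U ω)) fun i hi => (heU ω i hi).symm]
      _ = ∫⁻ q, p q.1 * b n (e q.1) q.2 ∂((P.map U).prod ρ) := by
          rw [← hmap, lintegral_map hqm (hUm.prodMk (hm n))]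
      _ = ∫⁻ u, p u * ∫⁻ x, b n (e u) x ∂ρ ∂(P.map U) := by
          rw [lintegral_prod _ hqm.aemeasurable]
          refine lintegral_congr fun u => ?_
          exact lintegral_const_mul (p u) (f := fun x => b n (e u) x)
            (hbm.comp measurable_prodMk_left)
      _ ≤ ∫⁻ u, p u * c n ∂(P.map U) := by
          gcongr with u
          exact hc n hn _
      _ = (∫⁻ ω, ∏ t ∈ Finset.Ico m n, b t (fun i => z i ω) (z t ω) ∂P) * c n := by
          rw [lintegral_mul_const _ hpm, lintegral_map hpm hUm]
          simp_rw [hpU]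
      _ ≤ _ := by
          rw [Finset.prod_Ico_succ_top hn]
          gcongr

/-- An exponential tail bound for sums along independent samples whose increments have
conditional exponential moments bounded by `exp (c t)`. -/
theorem measure_sum_Ico_ge_le (hm : ∀ t, Measurable (z t))
    (hlaw : ∀ t, P.map (z t) = ρ) (hind : iIndepFun z P) {h : ℕ → (ℕ → Z) → Z → ℝ}
    (hh : ∀ t, Measurable (Function.uncurry (h t)))
    (hdep : ∀ t w w', (∀ i < t, w i = w' i) → h t w = h t w') {c : ℕ → ℝ} {m n : ℕ}
    (hc : ∀ t, m ≤ t → ∀ w,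
      ∫⁻ x, ENNReal.ofReal (Real.exp (h t w x)) ∂ρ ≤ ENNReal.ofReal (Real.exp (c t)))
    (hmn : m ≤ n) {ℓ : ℝ} :
    P {ω | ∑ t ∈ Finset.Ico m n, c t + ℓ ≤
        ∑ t ∈ Finset.Ico m n, h t (fun i => z i ω) (z t ω)} ≤ ENNReal.ofReal (Real.exp (-ℓ)) := by
  have h1 := lintegral_prod_Ico_le_of_iIndepFun hm hlaw hind
    (b := fun t w x => ENNReal.ofReal (Real.exp (h t w x)))
    (fun t => (Real.measurable_exp.comp (hh t)).ennreal_ofReal)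
    (fun t w w' hw => by funext x; rw [hdep t w w' hw]) hc hmn
  have hprod : ∀ g : ℕ → ℝ, ∏ t ∈ Finset.Ico m n, ENNReal.ofReal (Real.exp (g t)) =
      ENNReal.ofReal (Real.exp (∑ t ∈ Finset.Ico m n, g t)) := by
    intro g
    rw [Real.exp_sum, ENNReal.ofReal_prod_of_nonneg fun _ _ => (Real.exp_pos _).le]
  simp_rw [hprod] at h1
  set Y : Ω → ℝ := fun ω => ∑ t ∈ Finset.Ico m n, h t (fun i => z i ω) (z t ω) with hY
  set C := ∑ t ∈ Finset.Ico m n, c t with hC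
  have hYm : Measurable Y := Finset.measurable_sum _ fun t _ =>
    (hh t).comp ((measurable_pi_lambda _ fun i => hm i).prodMk (hm t))
  have h2 : P {ω | C + ℓ ≤ Y ω} ≤
      P {ω | ENNReal.ofReal (Real.exp (C + ℓ)) ≤ ENNReal.ofReal (Real.exp (Y ω))} := by
    refine measure_mono fun ω hω => ?_
    exact ENNReal.ofReal_le_ofReal (Real.exp_le_exp.2 hω)
  refine h2.trans ((meas_ge_le_lintegral_div
    (Real.measurable_exp.comp hYm).ennreal_ofReal.aemeasurable (by simp [Real.exp_pos])
    ENNReal.ofReal_ne_top).trans ?_)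
  calc _ ≤ ENNReal.ofReal (Real.exp C) / ENNReal.ofReal (Real.exp (C + ℓ)) := by
        gcongr; exact h1
    _ = _ := by
        rw [← ENNReal.ofReal_div_of_pos (Real.exp_pos _), ← Real.exp_sub]
        congr 2; ring

theorem lintegral_exp_le_of_abs_le {X : Z → ℝ} {b : ℝ} (hX : Measurable X)
    (hb : ∀ x, |X x| ≤ b) (h0 : ∫ x, X x ∂ρ = 0) :
    ∫⁻ x, ENNReal.ofReal (Real.exp (X x)) ∂ρ ≤ ENNReal.ofReal (Real.exp (b ^ 2 / 2)) := by
  have h1 := hasSubgaussianMGF_of_mem_Icc_of_integral_eq_zero (a := -b) (b := b) hX.aemeasurable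
    (ae_of_all ρ fun x => abs_le.1 (hb x)) h0
  have h2 := h1.integrable_exp_mul 1
  have h3 := h1.mgf_le 1
  simp only [one_mul, mgf] at h2 h3
  rw [← ofReal_integral_eq_lintegral_ofReal h2 (ae_of_all _ fun x => (Real.exp_pos _).le)]
  refine ENNReal.ofReal_le_ofReal (h3.trans (Real.exp_le_exp.2 (le_of_eq ?_)))
  push_cast
  rw [Real.norm_eq_abs, div_pow, sq_abs]
  ring

/-- The drift `u` may be negative, so that it can compensate the Hoeffding variance term `b ^ 2 /
2`. -/
theorem lintegral_exp_le_of_le_add {X h : Z → ℝ} {b u c : ℝ} (hX : Measurable X)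
    (hb : ∀ x, |X x| ≤ b) (h0 : ∫ x, X x ∂ρ = 0) (hh : ∀ x, h x ≤ u + X x)
    (hc : u + b ^ 2 / 2 ≤ c) :
    ∫⁻ x, ENNReal.ofReal (Real.exp (h x)) ∂ρ ≤ ENNReal.ofReal (Real.exp c) := by
  calc _ ≤ ∫⁻ x, ENNReal.ofReal (Real.exp u) * ENNReal.ofReal (Real.exp (X x)) ∂ρ := by
        refine lintegral_mono fun x => ?_
        rw [← ENNReal.ofReal_mul (Real.exp_pos _).le, ← Real.exp_add]
        exact ENNReal.ofReal_le_ofReal (Real.exp_le_exp.2 (hh x))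
    _ = ENNReal.ofReal (Real.exp u) * ∫⁻ x, ENNReal.ofReal (Real.exp (X x)) ∂ρ :=
        lintegral_const_mul _ (Real.measurable_exp.comp hX).ennreal_ofReal
    _ ≤ ENNReal.ofReal (Real.exp u) * ENNReal.ofReal (Real.exp (b ^ 2 / 2)) := by
        gcongr
        exact lintegral_exp_le_of_abs_le hX hb h0
    _ ≤ _ := by
        rw [← ENNReal.ofReal_mul (Real.exp_pos _).le, ← Real.exp_add]
        exact ENNReal.ofReal_le_ofReal (Real.exp_le_exp.2 hc)

end Chain

/-! ### Boundedness of the iterates and the averaged excess risk -/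

noncomputable section

variable {Z H : Type*} [NormedAddCommGroup H] [InnerProductSpace ℝ H]

/-- Stochastic gradient descent along the samples `w 0, w 1, …` with step sizes `a 0, a 1, …`. -/
def sgd (k : Z → H) (ψ : Z → ℝ → ℝ) (a : ℕ → ℝ) (w : ℕ → Z) : ℕ → H
  | 0 => 0
  | t + 1 => sgd k ψ a w t - (a t * lossDeriv k ψ (sgd k ψ a w t) (w t)) • k (w t)

theorem sgd_congr {k : Z → H} {ψ : Z → ℝ → ℝ} {a : ℕ → ℝ} {w w' : ℕ → Z} (t : ℕ)
    (hw : ∀ i < t, w i = w' i) : sgd k ψ a w t = sgd k ψ a w' t := by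
  induction t with
  | zero => rfl
  | succ t ih =>
    rw [sgd, sgd, ih fun i hi => hw i (by omega), hw t (by omega)]

namespace IsHolderModel

variable [MeasurableSpace Z] {k : Z → H} {ψ : Z → ℝ → ℝ} {α L κ B : ℝ} {fs : H} {a : ℕ → ℝ}

theorem stronglyMeasurable_sgd (h : IsHolderModel k ψ α L κ B fs) (t : ℕ) :
    StronglyMeasurable fun w : ℕ → Z => sgd k ψ a w t := by
  induction t with
  | zero => exact stronglyMeasurable_const
  | succ t ih =>
    have h1 := (h.measurable_lossDeriv (measurable_pi_apply t) ih).const_mul (a t)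
    exact ih.sub (h1.stronglyMeasurable.smul (h.k_meas.comp_measurable (measurable_pi_apply t)))

variable {ρ : Measure Z} [IsProbabilityMeasure ρ]

theorem measurable_risk_sgd (h : IsHolderModel k ψ α L κ B fs) (t : ℕ) :
    Measurable fun w : ℕ → Z => risk ρ k ψ (sgd k ψ a w t) := by
  have h1 : Measurable fun q : (ℕ → Z) × Z => lossAt k ψ (sgd k ψ a q.1 t) q.2 :=
    h.measurable_lossAt measurable_snd ((h.stronglyMeasurable_sgd t).comp_measurable measurable_fst)
  exact h1.stronglyMeasurable.integral_prod_right'.measurable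

theorem stronglyMeasurable_riskGrad_sgd (h : IsHolderModel k ψ α L κ B fs) (t : ℕ) :
    StronglyMeasurable fun w : ℕ → Z => riskGrad ρ k ψ (sgd k ψ a w t) := by
  have h1 : StronglyMeasurable fun q : (ℕ → Z) × Z =>
      lossDeriv k ψ (sgd k ψ a q.1 t) q.2 • k q.2 :=
    h.stronglyMeasurable_grad measurable_snd
      ((h.stronglyMeasurable_sgd t).comp_measurable measurable_fst)
  exact h1.integral_prod_right'

variable {Ω : Type*} [MeasurableSpace Ω] {P : Measure Ω} [IsProbabilityMeasure P] {z : ℕ → Ω → Z}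
  {D S : ℝ}

/-- The squared distance of the iterates to a minimizer has exponential tails, uniformly in
time. -/
theorem measure_norm_sq_sgd_ge_le [CompleteSpace H] (h : IsHolderModel k ψ α L κ B fs)
    (hgrad : riskGrad ρ k ψ fs = 0) (hD : 0 ≤ D)
    (hS : ∀ n, ∑ i ∈ Finset.range n, a i ^ 2 ≤ S) (ha : ∀ t, 0 ≤ a t)
    (hstep : ∀ t f x, ‖f - (a t * lossDeriv k ψ f x) • k x - fs‖ ^ 2 ≤ ‖f - fs‖ ^ 2
      - 2 * a t * (lossDeriv k ψ fs x * inner ℝ (k x) (f - fs)) + D * a t ^ 2)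
    (hm : ∀ t, Measurable (z t)) (hlaw : ∀ t, P.map (z t) = ρ) (hind : iIndepFun z P)
    (n : ℕ) {ℓ : ℝ} (hℓ : 0 ≤ ℓ) :
    P {ω | Real.exp (2 * (growthConst L κ B * κ) ^ 2 * S) * (‖fs‖ ^ 2 + D * S + 1) * (1 + ℓ) ≤
      ‖sgd k ψ a (fun i => z i ω) n - fs‖ ^ 2} ≤ ENNReal.ofReal (Real.exp (-ℓ)) := by
  set c := 2 * (growthConst L κ B * κ) ^ 2 with hc
  have hc0 : 0 ≤ c := by positivity
  -- The discount shrinks by `exp (-c * a t ^ 2)` at each step, which offsets the noise variance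
  -- proxy, proportional to `a t ^ 2 * ‖f - fs‖ ^ 2`. It stays above `exp (-(c * S))`, whence the
  -- exponential factor in the radius.
  set lam : ℕ → ℝ := fun t => Real.exp (-(c * ∑ i ∈ Finset.range t, a i ^ 2)) with hlam
  have hlam0 : ∀ t, 0 < lam t := fun t => Real.exp_pos _
  have hlam1 : ∀ t, lam t ≤ 1 := fun t => by
    have : 0 ≤ c * ∑ i ∈ Finset.range t, a i ^ 2 :=
      mul_nonneg hc0 (Finset.sum_nonneg fun _ _ => sq_nonneg _)
    simpa [hlam] using this
  have hlamS : ∀ t, lam (t + 1) * (1 + c * a t ^ 2) ≤ lam t := fun t => by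
    have h1 : lam t = lam (t + 1) * Real.exp (c * a t ^ 2) := by
      simp only [hlam, ← Real.exp_add, Finset.sum_range_succ]
      congr 1; ring
    rw [h1]
    have := Real.add_one_le_exp (c * a t ^ 2)
    have := (hlam0 (t + 1)).le
    gcongr; linarith
  set g : ℕ → (ℕ → Z) → Z → ℝ := fun t w x =>
    lam (t + 1) * ‖sgd k ψ a w t - (a t * lossDeriv k ψ (sgd k ψ a w t) x) • k x - fs‖ ^ 2
      - lam t * ‖sgd k ψ a w t - fs‖ ^ 2 with hg
  have hgm : ∀ t, Measurable (Function.uncurry (g t)) := by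
    intro t
    have e1 : StronglyMeasurable fun q : (ℕ → Z) × Z => sgd k ψ a q.1 t :=
      (h.stronglyMeasurable_sgd t).comp_measurable measurable_fst
    have e2 := (h.measurable_lossDeriv measurable_snd e1).const_mul (a t)
    have e3 := (e1.sub (e2.stronglyMeasurable.smul (h.k_meas.comp_measurable measurable_snd))).sub
      (stronglyMeasurable_const (b := fs))
    exact ((e3.norm.measurable.pow_const 2).const_mul _).sub
      (((e1.sub stronglyMeasurable_const).norm.measurable.pow_const 2).const_mul _)
  have hgdep : ∀ t w w', (∀ i < t, w i = w' i) → g t w = g t w' := by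
    intro t w w' hw
    simp only [hg, sgd_congr t hw]
  have hgexp : ∀ t w, ∫⁻ x, ENNReal.ofReal (Real.exp (g t w x)) ∂ρ ≤
      ENNReal.ofReal (Real.exp (D * a t ^ 2)) := by
    intro t w
    set f := sgd k ψ a w t with hf
    obtain ⟨-, he⟩ := h.integral_lossDeriv_mul (ρ := ρ) fs (f - fs)
    have hl0 := hlam0 (t + 1)
    have hG := h.growthConst_nonneg
    refine lintegral_exp_le_of_le_add
      (X := fun x => -(2 * lam (t + 1) * a t) * (lossDeriv k ψ fs x * inner ℝ (k x) (f - fs)))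
      (b := 2 * lam (t + 1) * a t * (growthConst L κ B * (κ * ‖f - fs‖)))
      (u := (lam (t + 1) - lam t) * ‖f - fs‖ ^ 2 + lam (t + 1) * (D * a t ^ 2)) ?_ ?_ ?_ ?_ ?_
    · exact ((h.measurable_lossDeriv measurable_id stronglyMeasurable_const).mul
        (h.measurable_inner measurable_id stronglyMeasurable_const)).const_mul _
    · intro x
      have := ha t
      rw [abs_mul, abs_neg, abs_of_nonneg (by positivity : 0 ≤ 2 * lam (t + 1) * a t), abs_mul]
      gcongr
      · exact h.abs_lossDeriv_center_le x
      · exact h.abs_inner_le x _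
    · rw [integral_const_mul, he, hgrad, inner_zero_left, mul_zero]
    · intro x
      have := mul_le_mul_of_nonneg_left (hstep t f x) hl0.le
      simp only [hg, ← hf]
      linarith
    -- The Hoeffding term is quadratic in `lam (t + 1)`; as `lam (t + 1) ≤ 1`, it is dominated by
    -- the loss of discount `lam t - lam (t + 1)`.
    · have e1 := mul_le_mul_of_nonneg_right (hlamS t) (sq_nonneg ‖f - fs‖)
      have e2 : lam (t + 1) * (D * a t ^ 2) ≤ D * a t ^ 2 :=
        mul_le_of_le_one_left (mul_nonneg hD (sq_nonneg _)) (hlam1 _)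
      have e3 : (2 * lam (t + 1) * a t * (growthConst L κ B * (κ * ‖f - fs‖))) ^ 2 / 2 =
          lam (t + 1) * (lam (t + 1) * (c * a t ^ 2 * ‖f - fs‖ ^ 2)) := by
        rw [hc]; ring
      have e4 : lam (t + 1) * (lam (t + 1) * (c * a t ^ 2 * ‖f - fs‖ ^ 2)) ≤
          lam (t + 1) * (c * a t ^ 2 * ‖f - fs‖ ^ 2) := by
        exact mul_le_mul_of_nonneg_left
          (mul_le_of_le_one_left (by positivity) (hlam1 _)) hl0.le
      rw [e3]
      linarith
  refine (measure_mono fun ω hω => ?_).trans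
    (measure_sum_Ico_ge_le hm hlaw hind hgm hgdep (fun t _ => hgexp t) (Nat.zero_le n) (ℓ := ℓ))
  simp only [Set.mem_ofPred_eq] at hω ⊢
  have htel : ∑ t ∈ Finset.Ico 0 n, g t (fun i => z i ω) (z t ω) =
      lam n * ‖sgd k ψ a (fun i => z i ω) n - fs‖ ^ 2 - ‖fs‖ ^ 2 := by
    rw [← Finset.range_eq_Ico]
    have := Finset.sum_range_sub
      (fun t => lam t * ‖sgd k ψ a (fun i => z i ω) t - fs‖ ^ 2) n
    have h0 : lam 0 * ‖sgd k ψ a (fun i => z i ω) 0 - fs‖ ^ 2 = ‖fs‖ ^ 2 := by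
      simp [hlam, sgd]
    rw [h0] at this
    exact this
  rw [htel, ← Finset.mul_sum, ← Finset.range_eq_Ico]
  have hS0 : 0 ≤ S := by simpa using hS 0
  have e1 : Real.exp (-(c * S)) ≤ lam n := by
    refine Real.exp_le_exp.2 (neg_le_neg ?_)
    exact mul_le_mul_of_nonneg_left (hS n) hc0
  have e2 : (‖fs‖ ^ 2 + D * S + 1) * (1 + ℓ) ≤
      lam n * ‖sgd k ψ a (fun i => z i ω) n - fs‖ ^ 2 := by
    calc _ = Real.exp (-(c * S)) * (Real.exp (c * S) * (‖fs‖ ^ 2 + D * S + 1) * (1 + ℓ)) := by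
          rw [Real.exp_neg]; field_simp
      _ ≤ _ := by gcongr
  have e3 := mul_le_mul_of_nonneg_left (hS n) hD
  have e4 : 0 ≤ (‖fs‖ ^ 2 + D * S) * ℓ := by positivity
  linarith

theorem one_add_norm_sq_le {x M : ℝ} (hx : x ^ 2 ≤ M) : (1 + x) ^ 2 ≤ 2 * (1 + M) := by
  nlinarith [sq_nonneg (x - 1)]

/-- Tail bound for the weighted excess risk of the iterates that stay in a ball. -/
theorem measure_sum_excess_ge_le (h : IsHolderModel k ψ α L κ B fs)
    (hS : ∀ n, ∑ i ∈ Finset.range n, a i ^ 2 ≤ S) (ha : ∀ t, 0 ≤ a t)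
    (hm : ∀ t, Measurable (z t)) (hlaw : ∀ t, P.map (z t) = ρ) (hind : iIndepFun z P)
    {m n : ℕ} (hmn : m ≤ n) {M ℓ : ℝ} (hM : 0 ≤ M) (hℓ : 0 ≤ ℓ) :
    P {ω | (∀ t ∈ Finset.Ico m n, ‖sgd k ψ a (fun i => z i ω) t - fs‖ ^ 2 ≤ M) ∧
      (1 + M) * (1 + 10 * (growthConst L κ B * κ) ^ 2 * S) * (1 + ℓ) <
      ∑ t ∈ Finset.Ico m n, a t * (risk ρ k ψ (sgd k ψ a (fun i => z i ω) t) - risk ρ k ψ fs)} ≤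
      ENNReal.ofReal (Real.exp (-ℓ)) := by
  classical
  set G := growthConst L κ B with hGdef
  have hG : 0 ≤ G := h.growthConst_nonneg
  have hκ := h.hκ
  have hM1 : 0 < 1 + M := by linarith
  -- Truncation to the ball depends only on the past, so increments stay centred and become bounded.
  -- Division by `1 + M` makes that bound independent of `M`.
  set g : ℕ → (ℕ → Z) → Z → ℝ := fun t w x =>
    if ‖sgd k ψ a w t - fs‖ ^ 2 ≤ M then
      (a t / (1 + M)) * ((risk ρ k ψ (sgd k ψ a w t) - risk ρ k ψ fs) -
        (lossAt k ψ (sgd k ψ a w t) x - lossAt k ψ fs x)) else 0 with hg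
  have hgm : ∀ t, Measurable (Function.uncurry (g t)) := by
    intro t
    have e1 : StronglyMeasurable fun q : (ℕ → Z) × Z => sgd k ψ a q.1 t :=
      (h.stronglyMeasurable_sgd t).comp_measurable measurable_fst
    refine Measurable.ite (measurableSet_le
      ((e1.sub stronglyMeasurable_const).norm.measurable.pow_const 2) measurable_const) ?_
      measurable_const
    exact ((((h.measurable_risk_sgd t).comp measurable_fst).sub_const _).sub
      ((h.measurable_lossAt measurable_snd e1).sub
        (h.measurable_lossAt measurable_snd stronglyMeasurable_const))).const_mul _
  have hgdep : ∀ t w w', (∀ i < t, w i = w' i) → g t w = g t w' := by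
    intro t w w' hw
    simp only [hg, sgd_congr t hw]
  have hgexp : ∀ t w, ∫⁻ x, ENNReal.ofReal (Real.exp (g t w x)) ∂ρ ≤
      ENNReal.ofReal (Real.exp (8 * (G * κ) ^ 2 * a t ^ 2)) := by
    intro t w
    by_cases hw : ‖sgd k ψ a w t - fs‖ ^ 2 ≤ M
    · set f := sgd k ψ a w t with hf
      have hi : Integrable (fun x => lossAt k ψ f x - lossAt k ψ fs x) ρ :=
        (h.integrable_lossAt f).sub (h.integrable_lossAt fs)
      have hint : ∫ x, (lossAt k ψ f x - lossAt k ψ fs x) ∂ρ = risk ρ k ψ f - risk ρ k ψ fs :=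
        integral_sub (h.integrable_lossAt f) (h.integrable_lossAt fs)
      have hX : ∀ x, |lossAt k ψ f x - lossAt k ψ fs x| ≤ 2 * (G * κ * (1 + M)) := by
        intro x
        have := mul_le_mul_of_nonneg_left (one_add_norm_sq_le hw) (mul_nonneg hG hκ)
        linarith [h.abs_lossAt_sub_le x f]
      have hΔ : |risk ρ k ψ f - risk ρ k ψ fs| ≤ 2 * (G * κ * (1 + M)) := by
        have := norm_integral_le_of_norm_le_const (μ := ρ)
          (f := fun x => lossAt k ψ f x - lossAt k ψ fs x) (ae_of_all _ hX)
        rw [hint] at this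
        simpa using this
      refine lintegral_exp_le_of_le_add (u := 0) (b := 4 * (G * κ) * a t)
        (X := fun x => (a t / (1 + M)) * ((risk ρ k ψ f - risk ρ k ψ fs) -
          (lossAt k ψ f x - lossAt k ψ fs x))) ?_ ?_ ?_ ?_ ?_
      · exact (((h.measurable_lossAt measurable_id stronglyMeasurable_const).sub
          (h.measurable_lossAt measurable_id stronglyMeasurable_const)).const_sub _).const_mul _
      · intro x
        have hat := ha t
        rw [abs_mul, abs_of_nonneg (by positivity : 0 ≤ a t / (1 + M))]
        calc _ ≤ (a t / (1 + M)) * (2 * (G * κ * (1 + M)) + 2 * (G * κ * (1 + M))) := by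
              gcongr
              exact (abs_sub _ _).trans (add_le_add hΔ (hX x))
          _ = _ := by field_simp; ring
      · rw [integral_const_mul, integral_sub (integrable_const _) hi, hint]
        simp
      · intro x
        simp [hg, ← hf, hw]
      · apply le_of_eq; ring
    · have hat : 0 ≤ 8 * (G * κ) ^ 2 * a t ^ 2 := by positivity
      simp only [hg, hw, if_false, Real.exp_zero, lintegral_const, measure_univ, mul_one]
      exact ENNReal.ofReal_le_ofReal (Real.one_le_exp hat)
  refine (measure_mono fun ω hω => ?_).trans
    (measure_sum_Ico_ge_le hm hlaw hind hgm hgdep (fun t _ => hgexp t) hmn (ℓ := ℓ))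
  simp only [Set.mem_ofPred_eq] at hω ⊢
  obtain ⟨hball, hlt⟩ := hω
  set f : ℕ → H := fun t => sgd k ψ a (fun i => z i ω) t with hf
  have hsum : ∑ t ∈ Finset.Ico m n, g t (fun i => z i ω) (z t ω) =
      (1 + M)⁻¹ * (∑ t ∈ Finset.Ico m n, a t * (risk ρ k ψ (f t) - risk ρ k ψ fs) -
        ∑ t ∈ Finset.Ico m n, a t * (lossAt k ψ (f t) (z t ω) - lossAt k ψ fs (z t ω))) := by
    rw [← Finset.sum_sub_distrib, Finset.mul_sum]
    refine Finset.sum_congr rfl fun t ht => ?_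
    simp only [hg, if_pos (hball t ht), hf]
    ring
  have hS' : ∑ t ∈ Finset.Ico m n, a t ^ 2 ≤ S :=
    (Finset.sum_le_sum_of_subset_of_nonneg
      (by rw [Finset.range_eq_Ico]; exact Finset.Ico_subset_Ico_left (Nat.zero_le m))
      fun _ _ _ => sq_nonneg _).trans (hS n)
  have hS0 : 0 ≤ S := by simpa using hS 0
  -- The regret inequality: expand the squared distance after one step and bound the linear term by
  -- convexity.
  have hone : ∀ t ∈ Finset.Ico m n,
      2 * (a t * (lossAt k ψ (f t) (z t ω) - lossAt k ψ fs (z t ω))) ≤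
        (‖f t - fs‖ ^ 2 - ‖f (t + 1) - fs‖ ^ 2) + 2 * (G * κ) ^ 2 * (1 + M) * a t ^ 2 := by
    intro t ht
    set x := z t ω with hx
    set d := lossDeriv k ψ (f t) x with hd
    have e1 : ‖f (t + 1) - fs‖ ^ 2 = ‖f t - fs‖ ^ 2
        - 2 * (a t * (d * inner ℝ (k x) (f t - fs))) + a t ^ 2 * (d ^ 2 * ‖k x‖ ^ 2) := by
      have : f (t + 1) - fs = (f t - fs) - (a t * d) • k x := by
        simp only [hf, sgd, hd, hx]; abel
      rw [this, norm_sub_sq_real, inner_smul_right, real_inner_comm, norm_smul, mul_pow,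
        Real.norm_eq_abs, sq_abs]
      ring
    have e2 : d ^ 2 * ‖k x‖ ^ 2 ≤ 2 * (G * κ) ^ 2 * (1 + M) := by
      have e3 : d ^ 2 ≤ (G * (1 + ‖f t - fs‖)) ^ 2 := by
        rw [← sq_abs d]
        have := h.abs_lossDeriv_le x (f t)
        gcongr
      calc d ^ 2 * ‖k x‖ ^ 2 ≤ (G * (1 + ‖f t - fs‖)) ^ 2 * κ ^ 2 := by
            gcongr; exact h.k_norm x
        _ = (G * κ) ^ 2 * (1 + ‖f t - fs‖) ^ 2 := by ring
        _ ≤ (G * κ) ^ 2 * (2 * (1 + M)) := by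
            gcongr; exact one_add_norm_sq_le (hball t ht)
        _ = _ := by ring
    have e4 : lossAt k ψ (f t) x - lossAt k ψ fs x ≤ d * inner ℝ (k x) (f t - fs) := by
      have := (h.convex x).add_deriv_mul_sub_le (h.diff x) (inner ℝ (k x) (f t)) (inner ℝ (k x) fs)
      rw [inner_sub_right, hd]
      unfold lossAt lossDeriv
      linarith
    have e5 := mul_le_mul_of_nonneg_left e4 (ha t)
    have e6 := mul_le_mul_of_nonneg_left e2 (sq_nonneg (a t))
    linarith
  have htot := Finset.sum_le_sum hone
  rw [← Finset.mul_sum, Finset.sum_add_distrib, ← Finset.mul_sum] at htot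
  have htel : ∑ t ∈ Finset.Ico m n, (‖f t - fs‖ ^ 2 - ‖f (t + 1) - fs‖ ^ 2) ≤ M := by
    rcases hmn.eq_or_lt with rfl | hlt'
    · simpa using hM
    · have e1 := Finset.sum_Ico_sub (fun t => -‖f t - fs‖ ^ 2) hmn
      have e2 : ∑ t ∈ Finset.Ico m n, (‖f t - fs‖ ^ 2 - ‖f (t + 1) - fs‖ ^ 2) =
          ‖f m - fs‖ ^ 2 - ‖f n - fs‖ ^ 2 := by
        rw [show ‖f m - fs‖ ^ 2 - ‖f n - fs‖ ^ 2 = -‖f n - fs‖ ^ 2 - -‖f m - fs‖ ^ 2 by ring, ← e1]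
        exact Finset.sum_congr rfl fun t _ => by ring
      have e3 := hball m (Finset.mem_Ico.2 ⟨le_rfl, hlt'⟩)
      have e4 := sq_nonneg ‖f n - fs‖
      simp only [hf] at e2 e4 ⊢
      linarith
  rw [hsum, ← Finset.mul_sum, inv_mul_eq_div, le_div_iff₀ hM1]
  have e1 : 2 * (G * κ) ^ 2 * (1 + M) * ∑ t ∈ Finset.Ico m n, a t ^ 2 ≤
      2 * (G * κ) ^ 2 * (1 + M) * S := by gcongr
  have e2 : (8 * (G * κ) ^ 2 * ∑ t ∈ Finset.Ico m n, a t ^ 2) * (1 + M) ≤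
      (8 * (G * κ) ^ 2 * S) * (1 + M) := by gcongr
  have e3 : 0 ≤ (1 + M) * (10 * (G * κ) ^ 2 * S) * ℓ := by positivity
  have e4 : 0 ≤ (1 + M) * ((G * κ) ^ 2 * S) := by positivity
  linarith

end IsHolderModel
end

/-! ### Increase of the risk along the iterates -/

noncomputable section

variable {Z H : Type*} [NormedAddCommGroup H] [InnerProductSpace ℝ H]

namespace IsHolderModel

variable [MeasurableSpace Z] {k : Z → H} {ψ : Z → ℝ → ℝ} {α L κ B : ℝ} {fs : H} {a : ℕ → ℝ}
  {ρ : Measure Z} [IsProbabilityMeasure ρ]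
  {Ω : Type*} [MeasurableSpace Ω] {P : Measure Ω} [IsProbabilityMeasure P] {z : ℕ → Ω → Z}

theorem risk_sgd_succ_le [CompleteSpace H] (h : IsHolderModel k ψ α L κ B fs)
    (ha : ∀ t, 0 ≤ a t) (w : ℕ → Z) (t : ℕ) {M : ℝ} (hM : ‖sgd k ψ a w t - fs‖ ^ 2 ≤ M) :
    risk ρ k ψ (sgd k ψ a w (t + 1)) ≤ risk ρ k ψ (sgd k ψ a w t)
      - a t * (lossDeriv k ψ (sgd k ψ a w t) (w t) *
        inner ℝ (k (w t)) (riskGrad ρ k ψ (sgd k ψ a w t)))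
      + 2 * L * (1 + growthConst L κ B * κ ^ 2) ^ 2 * (1 + M) * a t ^ (1 + α) := by
  set f := sgd k ψ a w t with hf
  set d := lossDeriv k ψ f (w t) with hd
  set G := growthConst L κ B with hGdef
  have hG : 0 ≤ G := h.growthConst_nonneg
  have hκ := h.hκ
  have hL := h.hL
  have hα0 := h.hα0
  have hat := ha t
  have hn := norm_nonneg (f - fs)
  have e1 : sgd k ψ a w (t + 1) - f = -((a t) • (d • k (w t))) := by
    rw [sgd, smul_smul]; abel
  have e2 := h.risk_le_smooth (ρ := ρ) f (sgd k ψ a w (t + 1))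
  rw [e1, inner_neg_right, inner_smul_right, inner_smul_right, norm_neg, norm_smul,
    Real.norm_of_nonneg (ha t), real_inner_comm] at e2
  set y := (1 + G * κ ^ 2) * (1 + ‖f - fs‖) with hy
  have hGk : 0 ≤ G * κ ^ 2 := by positivity
  -- Having `y ≥ 1` lets the exponent `1 + α` be raised to `2`, so the error is linear in `1 + M`.
  have hy1 : 1 ≤ y := by
    rw [hy]; nlinarith [mul_nonneg hGk hn]
  have e3 : κ * (a t * ‖d • k (w t)‖) ≤ a t * y := by
    calc _ ≤ κ * (a t * (G * κ * (1 + ‖f - fs‖))) := by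
          gcongr; exact h.norm_grad_le f (w t)
      _ = a t * ((G * κ ^ 2) * (1 + ‖f - fs‖)) := by ring
      _ ≤ _ := by rw [hy]; gcongr; linarith
  have e4 : (κ * (a t * ‖d • k (w t)‖)) ^ (1 + α) ≤
      a t ^ (1 + α) * ((1 + G * κ ^ 2) ^ 2 * (2 * (1 + M))) := by
    calc _ ≤ (a t * y) ^ (1 + α) := Real.rpow_le_rpow (by positivity) e3 (by linarith)
      _ = a t ^ (1 + α) * y ^ (1 + α) := Real.mul_rpow hat (by linarith)
      _ ≤ a t ^ (1 + α) * y ^ (2 : ℝ) := by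
          gcongr
          · linarith [h.hα1]
      _ = a t ^ (1 + α) * ((1 + G * κ ^ 2) ^ 2 * (1 + ‖f - fs‖) ^ 2) := by
          rw [Real.rpow_two, hy, mul_pow]
      _ ≤ _ := by
          gcongr; exact one_add_norm_sq_le hM
  have e5 := mul_le_mul_of_nonneg_left e4 hL.le
  linarith

/-- Tail bound for the increase of the risk along iterates that stay in a ball. -/
theorem measure_risk_increase_ge_le [CompleteSpace H] (h : IsHolderModel k ψ α L κ B fs)
    (ha : ∀ t, 0 ≤ a t) (hm : ∀ t, Measurable (z t)) (hlaw : ∀ t, P.map (z t) = ρ)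
    (hind : iIndepFun z P) {m n : ℕ} (hmn : m ≤ n) {A M ℓ : ℝ} (hA : 0 < A)
    (hamA : ∀ t, m ≤ t → a t ≤ A) (hM : 0 ≤ M) :
    P {ω | (∀ t ∈ Finset.Ico m n, ‖sgd k ψ a (fun i => z i ω) t - fs‖ ^ 2 ≤ M) ∧
      4 * ((growthConst L κ B * κ) ^ 2 + 1) * (1 + M) * A * ℓ +
        2 * L * (1 + growthConst L κ B * κ ^ 2) ^ 2 * (1 + M) *
          ∑ t ∈ Finset.Ico m n, a t ^ (1 + α) <
      risk ρ k ψ (sgd k ψ a (fun i => z i ω) n) - risk ρ k ψ (sgd k ψ a (fun i => z i ω) m)} ≤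
      ENNReal.ofReal (Real.exp (-ℓ)) := by
  classical
  set G := growthConst L κ B with hGdef
  have hG : 0 ≤ G := h.growthConst_nonneg
  have hκ := h.hκ
  -- After division by `b`, the variance term is at most the descent `(a t / b) * ‖v‖ ^ 2`, so each
  -- exponential moment is at most one. The `+ 1` keeps `b` positive even if `G * κ = 0`.
  set b := 4 * ((G * κ) ^ 2 + 1) * (1 + M) * A with hb
  have hb0 : 0 < b := by positivity
  set g : ℕ → (ℕ → Z) → Z → ℝ := fun t w x =>
    if ‖sgd k ψ a w t - fs‖ ^ 2 ≤ M then
      -(a t / b) * (lossDeriv k ψ (sgd k ψ a w t) x *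
        inner ℝ (k x) (riskGrad ρ k ψ (sgd k ψ a w t))) else 0 with hg
  have hgm : ∀ t, Measurable (Function.uncurry (g t)) := by
    intro t
    have e1 : StronglyMeasurable fun q : (ℕ → Z) × Z => sgd k ψ a q.1 t :=
      (h.stronglyMeasurable_sgd t).comp_measurable measurable_fst
    refine Measurable.ite (measurableSet_le
      ((e1.sub stronglyMeasurable_const).norm.measurable.pow_const 2) measurable_const) ?_
      measurable_const
    exact ((h.measurable_lossDeriv measurable_snd e1).mul (h.measurable_inner measurable_snd
      ((h.stronglyMeasurable_riskGrad_sgd t).comp_measurable measurable_fst))).const_mul _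
  have hgdep : ∀ t w w', (∀ i < t, w i = w' i) → g t w = g t w' := by
    intro t w w' hw
    simp only [hg, sgd_congr t hw]
  have hgexp : ∀ t, m ≤ t → ∀ w, ∫⁻ x, ENNReal.ofReal (Real.exp (g t w x)) ∂ρ ≤
      ENNReal.ofReal (Real.exp 0) := by
    intro t hmt w
    by_cases hw : ‖sgd k ψ a w t - fs‖ ^ 2 ≤ M
    · set f := sgd k ψ a w t with hf
      set v := riskGrad ρ k ψ f with hv
      obtain ⟨hi, hint⟩ := h.integral_lossDeriv_mul (ρ := ρ) f v
      have hn := norm_nonneg (f - fs)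
      have hat := ha t
      refine lintegral_exp_le_of_le_add (u := -(a t / b) * ‖v‖ ^ 2)
        (b := (a t / b) * (‖v‖ * (2 * (G * κ * (1 + ‖f - fs‖)))))
        (X := fun x => (a t / b) * (‖v‖ ^ 2 - lossDeriv k ψ f x * inner ℝ (k x) v)) ?_ ?_ ?_ ?_ ?_
      · exact (((h.measurable_lossDeriv measurable_id stronglyMeasurable_const).mul
          (h.measurable_inner measurable_id stronglyMeasurable_const)).const_sub _).const_mul _
      · intro x
        rw [abs_mul, abs_of_nonneg (by positivity : 0 ≤ a t / b)]
        have e1 : ‖v‖ ^ 2 - lossDeriv k ψ f x * inner ℝ (k x) v =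
            inner ℝ v (v - lossDeriv k ψ f x • k x) := by
          rw [inner_sub_right, inner_smul_right, real_inner_self_eq_norm_sq, real_inner_comm]
        rw [e1]
        gcongr
        refine (abs_real_inner_le_norm _ _).trans ?_
        gcongr
        refine (norm_sub_le _ _).trans ?_
        linarith [h.norm_grad_le f x, h.norm_riskGrad_le (ρ := ρ) f]
      · rw [integral_const_mul, integral_sub (integrable_const _) hi, hint, ← hv,
          real_inner_self_eq_norm_sq]
        simp
      · intro x
        simp only [hg, ← hf, hw, if_true, ← hv]
        apply le_of_eq; ring
      · have e1 : (G * κ) ^ 2 * (1 + ‖f - fs‖) ^ 2 ≤ (G * κ) ^ 2 * (2 * (1 + M)) := by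
          gcongr; exact one_add_norm_sq_le hw
        have e2 : a t * (2 * ((G * κ) ^ 2 * (1 + ‖f - fs‖) ^ 2)) ≤ b := by
          calc _ ≤ A * (2 * ((G * κ) ^ 2 * (2 * (1 + M)))) := by
                gcongr; exact hamA t hmt
            _ ≤ b := by
                rw [hb]
                have : 0 ≤ A * (1 + M) := by positivity
                linarith
        have e3 : (a t / b) * (a t * (2 * ((G * κ) ^ 2 * (1 + ‖f - fs‖) ^ 2))) ≤
            (a t / b) * b := by gcongr
        have e4 : ((a t / b) * (‖v‖ * (2 * (G * κ * (1 + ‖f - fs‖))))) ^ 2 / 2 =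
            ‖v‖ ^ 2 / b * ((a t / b) * (a t * (2 * ((G * κ) ^ 2 * (1 + ‖f - fs‖) ^ 2)))) := by
          field_simp
        have e5 : ‖v‖ ^ 2 / b * ((a t / b) * (a t * (2 * ((G * κ) ^ 2 * (1 + ‖f - fs‖) ^ 2)))) ≤
            ‖v‖ ^ 2 / b * ((a t / b) * b) := by gcongr
        have e6 : ‖v‖ ^ 2 / b * ((a t / b) * b) = (a t / b) * ‖v‖ ^ 2 := by field_simp
        rw [e4]
        linarith
    · simp [hg, hw]
  refine (measure_mono fun ω hω => ?_).trans
    (measure_sum_Ico_ge_le hm hlaw hind hgm hgdep hgexp hmn (ℓ := ℓ))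
  simp only [Set.mem_ofPred_eq] at hω ⊢
  obtain ⟨hball, hlt⟩ := hω
  have hsum : b * ∑ t ∈ Finset.Ico m n, g t (fun i => z i ω) (z t ω) =
      ∑ t ∈ Finset.Ico m n, -(a t * (lossDeriv k ψ (sgd k ψ a (fun i => z i ω) t) (z t ω) *
        inner ℝ (k (z t ω)) (riskGrad ρ k ψ (sgd k ψ a (fun i => z i ω) t)))) := by
    rw [Finset.mul_sum]
    refine Finset.sum_congr rfl fun t ht => ?_
    simp only [hg, if_pos (hball t ht)]
    field_simp
  have htot := Finset.sum_le_sum fun t ht =>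
    sub_le_iff_le_add'.2 ((h.risk_sgd_succ_le (ρ := ρ) ha (fun i => z i ω) t (hball t ht)).trans_eq
      (show _ = risk ρ k ψ (sgd k ψ a (fun i => z i ω) t) + (-(a t * (lossDeriv k ψ
        (sgd k ψ a (fun i => z i ω) t) (z t ω) * inner ℝ (k (z t ω)) (riskGrad ρ k ψ
        (sgd k ψ a (fun i => z i ω) t)))) + 2 * L * (1 + growthConst L κ B * κ ^ 2) ^ 2 *
          (1 + M) * a t ^ (1 + α)) by ring))
  rw [Finset.sum_Ico_sub (fun t => risk ρ k ψ (sgd k ψ a (fun i => z i ω) t)) hmn,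
    Finset.sum_add_distrib, ← hsum, ← Finset.mul_sum] at htot
  have hlt' : b * ℓ < b * ∑ t ∈ Finset.Ico m n, g t (fun i => z i ω) (z t ω) := by linarith
  simpa using (lt_of_mul_lt_mul_left hlt' hb0.le).le

end IsHolderModel
end

/-! ### The last iterate: union bound and constants -/

noncomputable section

variable {Z H : Type*} [NormedAddCommGroup H] [InnerProductSpace ℝ H]

namespace IsHolderModel

variable [MeasurableSpace Z] {k : Z → H} {ψ : Z → ℝ → ℝ} {α L κ B : ℝ} {fs : H} {a : ℕ → ℝ}
  {ρ : Measure Z} [IsProbabilityMeasure ρ]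
  {Ω : Type*} [MeasurableSpace Ω] {P : Measure Ω} [IsProbabilityMeasure P] {z : ℕ → Ω → Z}
  {D S : ℝ}

/-- The scale of the squared radius of the ball that contains the iterates with high
probability. -/
def radiusConst (L κ B D S r : ℝ) : ℝ :=
  Real.exp (2 * (growthConst L κ B * κ) ^ 2 * S) * (r ^ 2 + D * S + 1)

/-- The constant in the high-probability bound for the excess risk of the last iterate. -/
def rateConst (α L κ B D S r a₀ : ℝ) : ℝ :=
  (1 + 2 * radiusConst L κ B D S r) * (2 * (1 + 10 * (growthConst L κ B * κ) ^ 2 * S)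
    + 4 * ((growthConst L κ B * κ) ^ 2 + 1) * a₀ ^ (1 - α)
    + 2 * L * (1 + growthConst L κ B * κ ^ 2) ^ 2)

theorem one_le_log_three_mul_div {n : ℕ} (hn : 1 ≤ n) {δ : ℝ} (hδ0 : 0 < δ) (hδ1 : δ < 1) :
    1 ≤ Real.log (3 * n / δ) := by
  have hn' : (1 : ℝ) ≤ n := by exact_mod_cast hn
  rw [Real.le_log_iff_exp_le (by positivity), le_div_iff₀ hδ0]
  have := Real.exp_one_lt_three
  nlinarith [Real.exp_pos 1]

theorem rate_sum_le {C₁ C₂ C₃ x₁ x₂ x₃ l : ℝ} (h₁ : 0 ≤ C₁) (h₂ : 0 ≤ C₂) (h₃ : 0 ≤ C₃) :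
    (C₁ * x₁ + C₂ * x₂ + C₃ * x₃) * l ^ 2 ≤ (C₁ + C₂ + C₃) * max x₁ (max x₂ x₃) * l ^ 2 := by
  have e1 : x₁ ≤ max x₁ (max x₂ x₃) := le_max_left _ _
  have e2 : x₂ ≤ max x₁ (max x₂ x₃) := (le_max_left _ _).trans (le_max_right _ _)
  have e3 : x₃ ≤ max x₁ (max x₂ x₃) := (le_max_right _ _).trans (le_max_right _ _)
  refine mul_le_mul_of_nonneg_right ?_ (sq_nonneg l)
  have f1 := mul_le_mul_of_nonneg_left e1 h₁
  have f2 := mul_le_mul_of_nonneg_left e2 h₂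
  have f3 := mul_le_mul_of_nonneg_left e3 h₃
  linarith

/-- Since `l ≥ 1`, both `1 + M ≤ (1 + 2 * C) * l` and `1 + l ≤ 2 * l`; every term is then at most a
constant times `l ^ 2`. -/
theorem le_rate {C G κ L S M l x u am p q v v' : ℝ} (hC : 0 ≤ C) (hG : 0 ≤ G)
    (hL : 0 ≤ L) (hS : 0 ≤ S) (hl : 1 ≤ l) (hM : M = C * (1 + l)) (hu : 0 ≤ u) (ham : 0 ≤ am)
    (hp : 0 ≤ p) (hpq : am ≤ p * q) (hv : 0 ≤ v) (hvv : v ≤ v')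
    (hx : x ≤ (1 + M) * (1 + 10 * (G * κ) ^ 2 * S) * (1 + l) * u +
      (4 * ((G * κ) ^ 2 + 1) * (1 + M) * am * l + 2 * L * (1 + G * κ ^ 2) ^ 2 * (1 + M) * v)) :
    x ≤ (1 + 2 * C) * (2 * (1 + 10 * (G * κ) ^ 2 * S) + 4 * ((G * κ) ^ 2 + 1) * p
      + 2 * L * (1 + G * κ ^ 2) ^ 2) * max u (max q v') * l ^ 2 := by
  have hM0 : 0 ≤ M := by rw [hM]; positivity
  have hM1 : 1 + M ≤ (1 + 2 * C) * l := by rw [hM]; nlinarith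
  have f1 : (1 + M) * (1 + 10 * (G * κ) ^ 2 * S) * (1 + l) * u ≤
      ((1 + 2 * C) * (2 * (1 + 10 * (G * κ) ^ 2 * S))) * u * l ^ 2 := by
    calc _ ≤ ((1 + 2 * C) * l) * (1 + 10 * (G * κ) ^ 2 * S) * (2 * l) * u := by
          gcongr; linarith
      _ = _ := by ring
  have f2 : 4 * ((G * κ) ^ 2 + 1) * (1 + M) * am * l ≤
      ((1 + 2 * C) * (4 * ((G * κ) ^ 2 + 1) * p)) * q * l ^ 2 := by
    calc _ ≤ 4 * ((G * κ) ^ 2 + 1) * ((1 + 2 * C) * l) * (p * q) * l := by gcongr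
      _ = _ := by ring
  have f3 : 2 * L * (1 + G * κ ^ 2) ^ 2 * (1 + M) * v ≤
      ((1 + 2 * C) * (2 * L * (1 + G * κ ^ 2) ^ 2)) * v' * l ^ 2 := by
    have hll : l ≤ l ^ 2 := by nlinarith
    calc _ ≤ 2 * L * (1 + G * κ ^ 2) ^ 2 * ((1 + 2 * C) * l ^ 2) * v' := by
          gcongr
          exact hM1.trans (by gcongr)
      _ = _ := by ring
  have f4 := rate_sum_le (C₁ := (1 + 2 * C) * (2 * (1 + 10 * (G * κ) ^ 2 * S)))
    (C₂ := (1 + 2 * C) * (4 * ((G * κ) ^ 2 + 1) * p))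
    (C₃ := (1 + 2 * C) * (2 * L * (1 + G * κ ^ 2) ^ 2)) (x₁ := u) (x₂ := q) (x₃ := v') (l := l)
    (by positivity) (by positivity) (by positivity)
  rw [← mul_add, ← mul_add] at f4
  linarith

/-- High-probability bound for the excess risk of the last iterate. -/
theorem ofReal_one_sub_le_measure_excess_risk [CompleteSpace H]
    (h : IsHolderModel k ψ α L κ B fs)
    (hgrad : riskGrad ρ k ψ fs = 0) (hD : 0 ≤ D)
    (hS : ∀ n, ∑ i ∈ Finset.range n, a i ^ 2 ≤ S) (ha : ∀ t, 0 < a t) (hanti : Antitone a)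
    (hstep : ∀ t f x, ‖f - (a t * lossDeriv k ψ f x) • k x - fs‖ ^ 2 ≤ ‖f - fs‖ ^ 2
      - 2 * a t * (lossDeriv k ψ fs x * inner ℝ (k x) (f - fs)) + D * a t ^ 2)
    (hm : ∀ t, Measurable (z t)) (hlaw : ∀ t, P.map (z t) = ρ) (hind : iIndepFun z P)
    {m n : ℕ} (hmn : m < n) {δ : ℝ} (hδ0 : 0 < δ) (hδ1 : δ < 1) :
    ENNReal.ofReal (1 - δ) ≤
      P {ω | risk ρ k ψ (sgd k ψ a (fun i => z i ω) n) - risk ρ k ψ fs ≤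
        rateConst α L κ B D S ‖fs‖ (a 0) * max (∑ t ∈ Finset.Ico m n, a t)⁻¹
          (max (a m ^ α) (∑ t ∈ Finset.Ico m n, a t ^ (1 + α))) *
            Real.log (3 * n / δ) ^ 2} := by
  set ℓ := Real.log (3 * n / δ) with hℓdef
  have hℓ : 1 ≤ ℓ := one_le_log_three_mul_div (by omega) hδ0 hδ1
  have hn0 : (0 : ℝ) < n := by exact_mod_cast (by omega : 0 < n)
  have hexp : Real.exp (-ℓ) = δ / (3 * n) := by
    rw [Real.exp_neg, hℓdef, Real.exp_log (by positivity), inv_div]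
  have ha' : ∀ t, 0 ≤ a t := fun t => (ha t).le
  have hS0 : 0 ≤ S := by simpa using hS 0
  have hL := h.hL
  have hκ := h.hκ
  have hG := h.growthConst_nonneg
  set G := growthConst L κ B with hGdef
  set C := radiusConst L κ B D S ‖fs‖ with hCdef
  have hC0 : 0 ≤ C := by
    rw [hCdef, radiusConst]; positivity
  set M := C * (1 + ℓ) with hMdef
  have hM0 : 0 ≤ M := by rw [hMdef]; positivity
  set f : Ω → ℕ → H := fun ω t => sgd k ψ a (fun i => z i ω) t with hf
  set c₂ := 4 * ((G * κ) ^ 2 + 1) * (1 + M) * a m * ℓ with hc₂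
  set c₃ := 2 * L * (1 + G * κ ^ 2) ^ 2 * (1 + M) with hc₃
  set good := {ω | risk ρ k ψ (f ω n) - risk ρ k ψ fs ≤
        rateConst α L κ B D S ‖fs‖ (a 0) * max (∑ t ∈ Finset.Ico m n, a t)⁻¹
          (max (a m ^ α) (∑ t ∈ Finset.Ico m n, a t ^ (1 + α))) * ℓ ^ 2} with hgood
  set far : ℕ → Set Ω := fun t => {ω | M ≤ ‖f ω t - fs‖ ^ 2} with hfar
  set big : Set Ω := {ω | (∀ t ∈ Finset.Ico m n, ‖f ω t - fs‖ ^ 2 ≤ M) ∧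
      (1 + M) * (1 + 10 * (G * κ) ^ 2 * S) * (1 + ℓ) <
      ∑ t ∈ Finset.Ico m n, a t * (risk ρ k ψ (f ω t) - risk ρ k ψ fs)} with hbig
  set jump : ℕ → Set Ω := fun s => {ω | (∀ t ∈ Finset.Ico s n, ‖f ω t - fs‖ ^ 2 ≤ M) ∧
      c₂ + c₃ * ∑ t ∈ Finset.Ico s n, a t ^ (1 + α) <
      risk ρ k ψ (f ω n) - risk ρ k ψ (f ω s)} with hjump
  have hPfar : ∀ t, P (far t) ≤ ENNReal.ofReal (Real.exp (-ℓ)) := fun t =>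
    h.measure_norm_sq_sgd_ge_le hgrad hD hS ha' hstep hm hlaw hind t (by linarith)
  have hPbig : P big ≤ ENNReal.ofReal (Real.exp (-ℓ)) :=
    h.measure_sum_excess_ge_le hS ha' hm hlaw hind hmn.le hM0 (by linarith)
  have hPjump : ∀ s ∈ Finset.Ico m n, P (jump s) ≤ ENNReal.ofReal (Real.exp (-ℓ)) := by
    intro s hs
    have hs' := Finset.mem_Ico.1 hs
    exact h.measure_risk_increase_ge_le ha' hm hlaw hind hs'.2.le (ha m)
      (fun t ht => hanti (hs'.1.trans ht)) hM0
  -- Off the bad events the bound is deterministic. The starting point `s` of the final stretch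
  -- depends on `ω`, so a jump event is needed for every `s` in the window.
  have hcover : (Set.univ : Set Ω) ⊆
      good ∪ (big ∪ ⋃ t ∈ Finset.Ico m n, (far t ∪ jump t)) := by
    intro ω _
    by_contra hω
    simp only [Set.mem_union, Set.mem_iUnion, not_or, not_exists] at hω
    obtain ⟨hω1, hω2, hω3⟩ := hω
    have hball : ∀ t ∈ Finset.Ico m n, ‖f ω t - fs‖ ^ 2 ≤ M := fun t ht =>
      (not_le.1 (hω3 t ht).1).le
    have hsum : ∑ t ∈ Finset.Ico m n, a t * (risk ρ k ψ (f ω t) - risk ρ k ψ fs) ≤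
        (1 + M) * (1 + 10 * (G * κ) ^ 2 * S) * (1 + ℓ) :=
      not_lt.1 fun hlt => hω2 ⟨hball, hlt⟩
    have hA : 0 < ∑ t ∈ Finset.Ico m n, a t :=
      Finset.sum_pos (fun t _ => ha t) (Finset.nonempty_Ico.2 hmn)
    -- Some iterate has excess risk no larger than the weighted average.
    obtain ⟨s, hs, hsle⟩ : ∃ s ∈ Finset.Ico m n, a s * (risk ρ k ψ (f ω s) - risk ρ k ψ fs) ≤
        a s * ((1 + M) * (1 + 10 * (G * κ) ^ 2 * S) * (1 + ℓ) *
          (∑ t ∈ Finset.Ico m n, a t)⁻¹) := by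
      refine Finset.exists_le_of_sum_le (Finset.nonempty_Ico.2 hmn) ?_
      rw [← Finset.sum_mul, mul_comm, mul_assoc, inv_mul_cancel₀ hA.ne', mul_one]
      exact hsum
    have hs1 := le_of_mul_le_mul_left hsle (ha s)
    have hs' := Finset.mem_Ico.1 hs
    have hsub : Finset.Ico s n ⊆ Finset.Ico m n := Finset.Ico_subset_Ico_left hs'.1
    have hs2 : risk ρ k ψ (f ω n) - risk ρ k ψ (f ω s) ≤
        c₂ + c₃ * ∑ t ∈ Finset.Ico s n, a t ^ (1 + α) :=
      not_lt.1 fun hlt => (hω3 s hs).2 ⟨fun t ht => hball t (hsub ht), hlt⟩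
    have hs3 : ∑ t ∈ Finset.Ico s n, a t ^ (1 + α) ≤ ∑ t ∈ Finset.Ico m n, a t ^ (1 + α) :=
      Finset.sum_le_sum_of_subset_of_nonneg hsub fun t _ _ => Real.rpow_nonneg (ha' t) _
    have ham : a m ≤ a 0 ^ (1 - α) * a m ^ α := by
      calc a m = a m ^ (1 - α) * a m ^ α := by
            rw [← Real.rpow_add (ha m)]; simp
        _ ≤ _ := by
            gcongr
            · exact Real.rpow_nonneg (ha' m) _
            · exact ha' m
            · linarith [h.hα1]
            · exact hanti (Nat.zero_le m)
    refine hω1 ?_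
    exact le_rate hC0 hG hL.le hS0 hℓ hMdef (inv_nonneg.2 hA.le) (ha' m)
      (Real.rpow_nonneg (ha' 0) _) ham
      (Finset.sum_nonneg fun t _ => Real.rpow_nonneg (ha' t) _) hs3
      (by linarith)
  have hbad : P (big ∪ ⋃ t ∈ Finset.Ico m n, (far t ∪ jump t)) ≤ ENNReal.ofReal δ := by
    calc _ ≤ P big + ∑ t ∈ Finset.Ico m n, (P (far t) + P (jump t)) :=
          (measure_union_le _ _).trans (add_le_add le_rfl
            ((measure_biUnion_finset_le _ _).trans
              (Finset.sum_le_sum fun t _ => measure_union_le _ _)))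
      _ ≤ ENNReal.ofReal (Real.exp (-ℓ)) + ∑ t ∈ Finset.Ico m n,
          (ENNReal.ofReal (Real.exp (-ℓ)) + ENNReal.ofReal (Real.exp (-ℓ))) :=
          add_le_add hPbig (Finset.sum_le_sum fun t ht => add_le_add (hPfar t) (hPjump t ht))
      _ = ENNReal.ofReal ((1 + 2 * ((n - m : ℕ) : ℝ)) * Real.exp (-ℓ)) := by
          rw [Finset.sum_const, Nat.card_Ico, ← ENNReal.ofReal_add (Real.exp_pos _).le
            (Real.exp_pos _).le, nsmul_eq_mul, ← ENNReal.ofReal_natCast,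
            ← ENNReal.ofReal_mul (by positivity),
            ← ENNReal.ofReal_add (Real.exp_pos _).le (by positivity)]
          congr 1; ring
      _ ≤ ENNReal.ofReal δ := by
          refine ENNReal.ofReal_le_ofReal ?_
          -- There is one averaging event and two events per time in the window, each of probability
          -- at most `δ / (3 * n)`; this is the `3` in the logarithm.
          have e1 : (1 + 2 * ((n - m : ℕ) : ℝ)) ≤ 3 * n := by
            exact_mod_cast (by omega : 1 + 2 * (n - m) ≤ 3 * n)
          rw [hexp, mul_div_assoc', div_le_iff₀ (by positivity), mul_comm δ]
          gcongr
  have hone : 1 ≤ P good + ENNReal.ofReal δ := by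
    calc (1 : ENNReal) = P Set.univ := measure_univ.symm
      _ ≤ P (good ∪ (big ∪ ⋃ t ∈ Finset.Ico m n, (far t ∪ jump t))) := measure_mono hcover
      _ ≤ _ := (measure_union_le _ _).trans (add_le_add le_rfl hbad)
  rw [ENNReal.ofReal_sub _ hδ0.le, ENNReal.ofReal_one]
  exact tsub_le_iff_right.2 hone

end IsHolderModel

theorem exists_forall_mul_rpow_le {α q : ℝ} (hα1 : α < 1) (hq : 0 ≤ q) :
    ∃ R : ℝ, ∀ s, R ≤ s → q * s ^ α ≤ s := by
  refine ⟨max 1 (q ^ (1 / (1 - α))), fun s hs => ?_⟩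
  have hs0 : 0 < s := lt_of_lt_of_le one_pos ((le_max_left _ _).trans hs)
  have h1 : 0 < 1 - α := by linarith
  have h2 : q ≤ s ^ (1 - α) := by
    calc q = (q ^ (1 / (1 - α))) ^ (1 - α) := by
          rw [← Real.rpow_mul hq, one_div_mul_cancel h1.ne', Real.rpow_one]
      _ ≤ _ := Real.rpow_le_rpow (Real.rpow_nonneg hq _) ((le_max_right _ _).trans hs) h1.le
  calc q * s ^ α ≤ s ^ (1 - α) * s ^ α := by gcongr
    _ = s := by rw [← Real.rpow_add hs0]; simp

theorem stepConst_one {L : ℝ} : stepConst 1 L = 4 * L := by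
  norm_num [stepConst]; ring

/-! ### Translation from the reproducing kernel Hilbert space -/

section Kernel

variable {X : Type*} [CompleteSpace H] [RKHS ℝ H X ℝ]

theorem inner_kernelSection (x : X) (f : H) : inner ℝ (kernelSection H x) f = f x := by
  simp [kernelSection]

theorem inner_kernelSection_kernelSection {K : X → X → ℝ} (hH : IsRKHSOf H K) (x y : X) :
    inner ℝ (kernelSection H x) (kernelSection H y) = K x y := by
  rw [inner_kernelSection, ← hH x y, kernelSection, RKHS.kerFun_apply]

theorem norm_kernelSection {K : X → X → ℝ} (hH : IsRKHSOf H K) (x : X) :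
    ‖kernelSection H x‖ = √(K x x) := by
  rw [← inner_kernelSection_kernelSection hH, real_inner_self_eq_norm_sq,
    Real.sqrt_sq (norm_nonneg _)]

/-- The squared distance of two sections is `K x x - 2 * K x y + K y y`. As the input space is
second countable, continuity yields strong measurability without separability of `H`. -/
theorem continuous_kernelSection [TopologicalSpace X] {K : X → X → ℝ} (hH : IsRKHSOf H K)
    (hK : Continuous fun p : X × X => K p.1 p.2) :
    Continuous fun x => kernelSection H x := by
  rw [continuous_iff_continuousAt]
  intro y
  rw [ContinuousAt, tendsto_iff_norm_sub_tendsto_zero]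
  have h1 : ∀ x, ‖kernelSection H x - kernelSection H y‖ = √(K x x - 2 * K x y + K y y) := by
    intro x
    rw [← inner_kernelSection_kernelSection hH x x, ← inner_kernelSection_kernelSection hH y y,
      ← inner_kernelSection_kernelSection hH x y, real_inner_self_eq_norm_sq,
      real_inner_self_eq_norm_sq, ← norm_sub_sq_real, Real.sqrt_sq (norm_nonneg _)]
  simp_rw [h1]
  have h2 : Continuous fun x => √(K x x - 2 * K x y + K y y) :=
    (((hK.comp (continuous_id.prodMk continuous_id)).sub
      ((hK.comp (continuous_id.prodMk continuous_const)).const_mul 2)).add continuous_const).sqrt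
  have h3 := h2.tendsto y
  rwa [show K y y - 2 * K y y + K y y = 0 by ring, Real.sqrt_zero] at h3

theorem ogd_succ_eq_sgd {Y : Type*} (φ : Y → ℝ → ℝ) (η : ℕ → ℝ) (z : ℕ → X × Y) (t : ℕ) :
    ogd H φ η z (t + 1) = sgd (fun p : X × Y => kernelSection H p.1) (fun p => φ p.2)
      (fun t => η (t + 1)) (fun t => z (t + 1)) t := by
  induction t with
  | zero => rfl
  | succ t ih => rw [ogd, sgd, ← ih, lossDeriv, inner_kernelSection]

end Kernel

end

theorem proposition5
    -- input space, output space, and the distribution of an example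
    {d : ℕ} (𝒳 : Set (EuclideanSpace ℝ (Fin d))) (𝒴 : Set ℝ)
    (ρ : Measure (𝒳 × 𝒴)) [IsProbabilityMeasure ρ]
    -- the Mercer kernel and its reproducing kernel Hilbert space
    (K : 𝒳 → 𝒳 → ℝ) (hK : IsMercerKernel K)
    (hκ : BddAbove (Set.range fun x => √(K x x)))
    (H : Type*) [NormedAddCommGroup H] [InnerProductSpace ℝ H] [CompleteSpace H]
    [RKHS ℝ H 𝒳 ℝ] (hH : IsRKHSOf H K)
    -- the loss function
    (α L : ℝ) (hα0 : 0 < α) (hα1 : α ≤ 1) (hL : 0 < L)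
    (φ : 𝒴 → ℝ → ℝ) (hφ : IsHolderLoss φ α L)
    (hφ0 : BddAbove (Set.range fun y => φ y 0))
    -- a minimizer of the generalization error over the space
    (fH : H) (hfH : ∀ f : H, genError ρ φ fH ≤ genError ρ φ f)
    (hφH : BddAbove (Set.range fun z : 𝒳 × 𝒴 => φ z.2 (fH z.1)))
    -- the step sizes
    (η : ℕ → ℝ) (hη0 : ∀ t, 1 ≤ t → 0 < η t)
    (hηA : ∀ t, 1 ≤ t → η t * (stepConst α L * kernelRadius K ^ 2) ≤ 1)
    (hηmono : ∀ t, 1 ≤ t → η (t + 1) ≤ η t)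
    (hηsum : Summable fun t => η t ^ 2) :
    ∃ C : ℝ,
      -- any sequence of independent examples drawn from the distribution
      ∀ (Ω : Type*) [MeasurableSpace Ω] (P : Measure Ω) [IsProbabilityMeasure P]
        (z : ℕ → Ω → 𝒳 × 𝒴),
        (∀ t, 1 ≤ t → Measurable (z t)) →
        (∀ t, 1 ≤ t → P.map (z t) = ρ) →
        iIndepFun (fun t : ℕ => z (t + 1)) P →
        ∀ T T' : ℕ, 1 ≤ T' → T' ≤ T → ∀ δ : ℝ, 0 < δ → δ < 1 →
          ENNReal.ofReal (1 - δ) ≤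
            P {ω | genError ρ φ (ogd H φ η (fun t => z t ω) (T + 1)) - genError ρ φ fH ≤
              C * max (∑ t ∈ Finset.Icc T' T, η t)⁻¹
                    (max (η T' ^ α) (∑ t ∈ Finset.Icc T' T, η t ^ (1 + α))) *
                Real.log (3 * T / δ) ^ 2} := by
  classical
  obtain ⟨B, hB⟩ := hφH
  set k : 𝒳 × 𝒴 → H := fun p => kernelSection H p.1 with hk
  set ψ : 𝒳 × 𝒴 → ℝ → ℝ := fun p => φ p.2 with hψ
  set κ := kernelRadius K with hκdef
  have hκ0 : 0 ≤ κ := Real.iSup_nonneg fun x => Real.sqrt_nonneg _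
  have hmodel : IsHolderModel k ψ α L κ |B| fH :=
    { hα0 := hα0
      hα1 := hα1
      hL := hL
      hκ := hκ0
      hB := abs_nonneg B
      k_meas := (continuous_kernelSection hH hK.continuous).stronglyMeasurable.comp_measurable
        measurable_fst
      k_norm := fun p => by
        rw [hk, norm_kernelSection hH]
        exact le_ciSup hκ p.1
      ψ_meas := hφ.measurable.comp ((measurable_snd.comp measurable_fst).prodMk measurable_snd)
      nonneg := fun p s => hφ.nonneg _ _
      convex := fun p => hφ.convex _
      diff := fun p => hφ.differentiable _
      holder := fun p => hφ.holder _
      bound := fun p => by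
        rw [hk, inner_kernelSection]
        exact (hB ⟨p, rfl⟩).trans (le_abs_self B) }
  have hrisk : ∀ f : H, genError ρ φ f = risk ρ k ψ f := by
    intro f
    simp only [genError, risk, lossAt, hk, hψ, inner_kernelSection]
  -- The descent model starts at time `0` and `ogd` at time `1`, hence the shift of steps and
  -- samples; `T' = m + 1` later turns `Icc T' T` into `Ico m T`.
  set a : ℕ → ℝ := fun t => η (t + 1) with ha
  have ha0 : ∀ t, 0 < a t := fun t => hη0 _ (by omega)
  have hanti : Antitone a := antitone_nat_of_succ_le fun t => hηmono _ (by omega)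
  have hasum : Summable fun t => a t ^ 2 := (summable_nat_add_iff 1).2 hηsum
  -- One threshold must serve all times. For `α < 1` sublinear growth provides it at the largest
  -- step `a 0`; for `α = 1` the step-size condition reads `a t * (4 * L * κ ^ 2) ≤ 1`, and `R = 0`
  -- works.
  obtain ⟨R, hR⟩ : ∃ R : ℝ, ∀ t s, R ≤ s → a t * (κ ^ 2 * L) * s ^ α ≤ s := by
    rcases hα1.lt_or_eq with hlt | rfl
    · have h0 := (ha0 0).le
      obtain ⟨R, hR⟩ := exists_forall_mul_rpow_le hlt
        (by positivity : 0 ≤ a 0 * (κ ^ 2 * L))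
      refine ⟨max 0 R, fun t s hs => le_trans ?_ (hR s ((le_max_right _ _).trans hs))⟩
      have hs0 : 0 ≤ s := (le_max_left _ _).trans hs
      have := hanti (Nat.zero_le t)
      gcongr
    · refine ⟨0, fun t s hs => ?_⟩
      have h1 := hηA (t + 1) (by omega)
      rw [stepConst_one] at h1
      rw [Real.rpow_one]
      have h2 : 0 ≤ a t * (κ ^ 2 * L) := by have := (ha0 t).le; positivity
      refine mul_le_of_le_one_left hs ?_
      have h3 : a t * (4 * L * κ ^ 2) ≤ 1 := h1
      linarith
  have hgrad : riskGrad ρ k ψ fH = 0 :=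
    hmodel.riskGrad_eq_zero fun f => by simpa only [hrisk] using hfH f
  refine ⟨IsHolderModel.rateConst α L κ |B|
    (2 * κ ^ 2 * (growthConst L κ |B| ^ 2 + (L * R ^ α) ^ 2)) (∑' t, a t ^ 2) ‖fH‖ (a 0), ?_⟩
  intro Ω _ P _ z hm hlaw hind T T' hT' hTT' δ hδ0 hδ1
  obtain ⟨m, rfl⟩ : ∃ m, T' = m + 1 := ⟨T' - 1, by omega⟩
  have main := hmodel.ofReal_one_sub_le_measure_excess_risk (P := P)
    (z := fun t => z (t + 1)) hgrad (by positivity)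
    (fun n => hasum.sum_le_tsum _ fun _ _ => sq_nonneg _) ha0 hanti
    (fun t f x => hmodel.norm_sq_step_le (ha0 t).le (hR t) f x)
    (fun t => hm _ (by omega)) (fun t => hlaw _ (by omega)) hind
    (show m < T by omega) hδ0 hδ1
  have hsum : ∀ F : ℕ → ℝ, ∑ t ∈ Finset.Icc (m + 1) T, F t =
      ∑ t ∈ Finset.Ico m T, F (t + 1) := by
    intro F
    rw [Finset.sum_Ico_add' F m T 1]
    rfl
  simp only [hsum, hrisk, ogd_succ_eq_sgd]
  exact main
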